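/- Let $n\ge 0$, let $A\in M_n(\mathbb Z)$ be symmetric and positive definite, let $\tau\in\mathbb C$ with $\operatorname{Im}\tau>0$, let $u\in\mathbb C^n$, and let $\epsilon\in\mathbb C^n$ with $\operatorname{Re}\epsilon_j\neq 0$ for all $j$. Write $(x,y)=\sum_j x_jy_j$ and $q^x=e^{2\pi i\tau x}$. Define the regularized partial theta function $$P_\epsilon(u,\tau)=\sum_{k\in(\mathbb Z_{\ge0}+\frac12)^n}e^{\pi i\tau (k,Ak)}\,e^{2\pi i(k,Au)}\,e^{2\pi(k,\epsilon)},$$ the function of $w\in\mathbb C^n$ $$F(w)=\frac{q^{\frac12(w,A^{-1}w)}e^{-2\pi i(u,w)}}{\prod_{j=1}^n\sin(\pi(i\epsilon_j-w_j))},$$ the factor $$c=e^{\frac{\pi i}{\tau}(u,Au)}\,(2i)^{-n}\,\sqrt{\frac{(-i\tau)^n}{\det A}},\qquad \sqrt{\frac{(-i\tau)^n}{\det A}}:=\frac{(-i\tau)^{n/2}}{\sqrt{\det A}}\ \text{ (principal power)},$$ and $h_\epsilon(u,\tau)=c\int_{\mathbb R^n}F(w)\,d^nw$. Let $\alpha\in\mathbb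 R^n$ have the components $\alpha_j=(1+\operatorname{sgn}(\operatorname{Re}\epsilon_j))\operatorname{Re}\epsilon_j$ and let $$I=\int_{\mathbb R^n+i\alpha}F(w)\,d^nw-\int_{\mathbb R^n}F(w)\,d^nw .$$ For a finite set $v$, a symmetric $v\times v$ matrix $B$ and $x,\eta\in\mathbb C^v$ put $$\theta_{B,\eta}(x;\tau)=\sum_{m\in\mathbb Z^v}(-1)^{\sum_j m_j}q^{\frac12(m+i\eta,B(m+i\eta))}e^{2\pi i(x,m+i\eta)} .$$ For a nonempty $v\subseteq\{1,\dots,n\}$ let $B^{(v)}=((A^{-1})_{ab})_{a,b\in v}$, let $u^{(v)},\epsilon^{(v)}$ be the restrictions of $u,\epsilon$ to the coordinates in $v$, and, for $w\in\mathbb R^{\{1,\dots,n\}\setminus v}$, extended by $0$ to a vector $w^{(v)}\in\mathbb R^n$, let $x^{(v)}(w^{(v)})=((A^{-1}w^{(v)})_a)_{a\in v}$. Put $$I^{(v)}=\int_{\mathbb R^{n-|v|}}\theta_{B^{(v)},\epsilon^{(v)}}\big(x^{(v)}(w^{(v)})\tau-u^{(v)};\tau\big)\,\frac{q^{\frac12(w^{(v)},A^{-1}w^{(v)})}e^{-2\pi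 i(u,w^{(v)})}}{\prod_{j\notin v}\sin(\pi(i\epsilon_j-w_j))}\,d^{n-|v|}w .$$ Then all these series and integrals converge absolutely (the series $P_\epsilon$ at $(\frac u\tau,-\frac1\tau)$), $$I=\sum_{\emptyset\neq v\subseteq\{1,\dots,n\}}i^{|v|}\Big(\prod_{j\in v}\big(1+\operatorname{sgn}(\operatorname{Re}\epsilon_j)\big)\Big)I^{(v)},$$ and $$P_\epsilon\Big(\frac u\tau,-\frac1\tau\Big)=h_\epsilon(u,\tau)+c\,I .$$ -/

import Mathlib

open Complex MeasureTheory
open scoped Matrix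

noncomputable section

namespace PartialTheta

/-- `q ^ x` with `q = exp (2 π i τ)`, that is `exp (2 π i τ x)`. -/
def qPow (τ x : ℂ) : ℂ := cexp (2 * Real.pi * I * τ * x)

/-- The integral matrix `A` viewed as a complex matrix. -/
def toC {n : ℕ} (A : Matrix (Fin n) (Fin n) ℤ) : Matrix (Fin n) (Fin n) ℂ :=
  A.map (fun a => (a : ℂ))

/-- The point `k + (1/2, …, 1/2)`, for `k` a vector of natural numbers. -/
def halfShift {n : ℕ} (k : Fin n → ℕ) : Fin n → ℂ := fun j => (k j : ℂ) + 1 / 2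

/-- The term of the regularized partial theta series at the lattice point `k + (1/2, …, 1/2)`. -/
def partialThetaTerm {n : ℕ} (A : Matrix (Fin n) (Fin n) ℤ) (ε u : Fin n → ℂ) (τ : ℂ)
    (k : Fin n → ℕ) : ℂ :=
  qPow τ (1 / 2 * (halfShift k ⬝ᵥ toC A *ᵥ halfShift k)) *
    cexp (2 * Real.pi * I * (halfShift k ⬝ᵥ toC A *ᵥ u)) *
    cexp (2 * Real.pi * (halfShift k ⬝ᵥ ε))

/-- The regularized partial theta function `P_ε(u, τ)`. -/
def partialTheta {n : ℕ} (A : Matrix (Fin n) (Fin n) ℤ) (ε u : Fin n → ℂ) (τ : ℂ) : ℂ :=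
  ∑' k : Fin n → ℕ, partialThetaTerm A ε u τ k

/-- The function
`q ^ ((w, A⁻¹ w) / 2) * exp (-2 π i (u, w)) / ∏ j, sin (π (i ε_j - w_j))` of `w ∈ ℂⁿ`. -/
def integrand {n : ℕ} (A : Matrix (Fin n) (Fin n) ℤ) (ε u : Fin n → ℂ) (τ : ℂ)
    (w : Fin n → ℂ) : ℂ :=
  qPow τ (1 / 2 * (w ⬝ᵥ (toC A)⁻¹ *ᵥ w)) * cexp (-(2 * Real.pi * I * (u ⬝ᵥ w))) /
    ∏ j, Complex.sin (Real.pi * (I * ε j - w j))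

/-- The factor `exp (π i (u, A u) / τ) (2 i)^(-n) √((-i τ)^n / det A)`. The square root is the
holomorphic branch on the upper half-plane that is positive for `τ` on the positive imaginary
axis, i.e. `(-i τ)^(n/2) / √(det A)` with the principal power. -/
def prefactor {n : ℕ} (A : Matrix (Fin n) (Fin n) ℤ) (u : Fin n → ℂ) (τ : ℂ) : ℂ :=
  cexp (Real.pi * I / τ * (u ⬝ᵥ toC A *ᵥ u)) * ((2 * I) ^ n)⁻¹ *
    ((-I * τ) ^ ((n : ℂ) / 2) / (Real.sqrt (A.det : ℝ) : ℂ))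

/-- The point `w + i α` of `ℂⁿ`, for real vectors `w` and `α`. -/
def shiftedPoint {n : ℕ} (α w : Fin n → ℝ) : Fin n → ℂ := fun j => (w j : ℂ) + I * (α j : ℂ)

/-- The integral of a function on `ℂⁿ` over the translated real subspace `ℝⁿ + i α`. -/
def planeIntegral {n : ℕ} (α : Fin n → ℝ) (F : (Fin n → ℂ) → ℂ) : ℂ :=
  ∫ w : Fin n → ℝ, F (shiftedPoint α w)

/-- The continuous part `h_ε(u, τ)`. -/
def continuousPart {n : ℕ} (A : Matrix (Fin n) (Fin n) ℤ) (ε u : Fin n → ℂ) (τ : ℂ) : ℂ :=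
  prefactor A u τ * planeIntegral 0 (integrand A ε u τ)

/-- The real vector `α` with components `(1 + sgn (Re ε_j)) Re ε_j`. -/
def shiftVector {n : ℕ} (ε : Fin n → ℂ) : Fin n → ℝ :=
  fun j => (1 + Real.sign (ε j).re) * (ε j).re

/-- The integral `I` over the contour that consists of `ℝⁿ + i α` and of `ℝⁿ` with the
orientation reversed, joined at infinity. -/
def contourIntegral {n : ℕ} (A : Matrix (Fin n) (Fin n) ℤ) (ε u : Fin n → ℂ) (τ : ℂ) : ℂ :=
  planeIntegral (shiftVector ε) (integrand A ε u τ) - planeIntegral 0 (integrand A ε u τ)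

/-- The term at `m + i ε`, `m ∈ ℤ^ι`, of the theta series `θ_{B, ε}(u; τ)`. -/
def thetaTerm {ι : Type*} [Fintype ι] (B : Matrix ι ι ℂ) (ε u : ι → ℂ) (τ : ℂ)
    (m : ι → ℤ) : ℂ :=
  let x : ι → ℂ := fun i => (m i : ℂ) + I * ε i
  (-1 : ℂ) ^ (∑ i, m i) * qPow τ (1 / 2 * (x ⬝ᵥ B *ᵥ x)) * cexp (2 * Real.pi * I * (u ⬝ᵥ x))

/-- The theta function `θ_{B, ε}(u; τ)`; its rank is the cardinality of `ι`. -/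
def theta {ι : Type*} [Fintype ι] (B : Matrix ι ι ℂ) (ε u : ι → ℂ) (τ : ℂ) : ℂ :=
  ∑' m : ι → ℤ, thetaTerm B ε u τ m

section Subsets

variable {n : ℕ} (A : Matrix (Fin n) (Fin n) ℤ) (v : Finset (Fin n))

/-- The vector `w^{(v)}` of `ℂⁿ`: its coordinates outside `v` are those of `w`, the others
vanish. -/
def extendZero (w : {i // i ∉ v} → ℝ) : Fin n → ℂ :=
  fun i => if h : i ∉ v then (w ⟨i, h⟩ : ℂ) else 0

/-- The matrix `B^{(v)}`: the rows and columns of `A⁻¹` with index in `v`. -/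
def subInverse : Matrix {i // i ∈ v} {i // i ∈ v} ℂ :=
  ((toC A)⁻¹).submatrix Subtype.val Subtype.val

/-- The vector `x^{(v)}(w^{(v)})`: the coordinates of `A⁻¹ w^{(v)}` with index in `v`. -/
def crossVector (w : {i // i ∉ v} → ℝ) : {i // i ∈ v} → ℂ :=
  fun i => ((toC A)⁻¹ *ᵥ extendZero v w) i

/-- The elliptic argument `x^{(v)}(w^{(v)}) τ - u^{(v)}` of the theta function. -/
def thetaArgument (u : Fin n → ℂ) (τ : ℂ) (w : {i // i ∉ v} → ℝ) : {i // i ∈ v} → ℂ :=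
  fun i => crossVector A v w i * τ - u i

/-- The restriction of a vector to the coordinates in `v`. -/
def restrict (x : Fin n → ℂ) : {i // i ∈ v} → ℂ := fun i => x i

/-- The integrand of `I^{(v)}`. -/
def subsetIntegrand (ε u : Fin n → ℂ) (τ : ℂ) (w : {i // i ∉ v} → ℝ) : ℂ :=
  theta (subInverse A v) (restrict v ε) (thetaArgument A v u τ w) τ *
    (qPow τ (1 / 2 * (extendZero v w ⬝ᵥ (toC A)⁻¹ *ᵥ extendZero v w)) *
      cexp (-(2 * Real.pi * I * (u ⬝ᵥ extendZero v w))) /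
      ∏ j : {i // i ∉ v}, Complex.sin (Real.pi * (I * ε j - w j)))

/-- The integral `I^{(v)}` over `ℝ^{n - |v|}`. -/
def subsetIntegral (ε u : Fin n → ℂ) (τ : ℂ) : ℂ :=
  ∫ w : {i // i ∉ v} → ℝ, subsetIntegrand A v ε u τ w

end Subsets

end PartialTheta

end

/-! In the lower half-plane `1 / sin (π z)` is a geometric series. Each component of `α` is `0` or
`2 Re ε_j`, and both exceed `Re ε_j`, so on `ℝⁿ + i α` every `i ε_j - w_j` lies in the lower
half-plane and the product of cosecants can be expanded. Integrated termwise, `F` gives Gaussian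
integrals with a linear exponent. Multiplied by `c`, these are exactly the terms of `P_ε` at `(u /
τ, -1 / τ)` (`integral_numer_mul_prod_cscTerm`, `hasSum_partialThetaTerm`). The transformation
formula is then the decomposition of the integral over `ℝⁿ + i α` into the one over `ℝⁿ` plus `I`.

To evaluate `I`, one coordinate is moved at a time. If `Re ε_j < 0` nothing moves; otherwise the
line crosses the poles `m + i ε_j`, with contribution `2 i ∑ (-1)^m (…)`. This comes from Poisson
summation rather than from residues (`integral_gauss_div_sin_sub`): the cosecant expansions on the
two lines supply the Fourier coefficients with `k ≥ 0` and with `k < 0` of one Gaussian.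

A sum over poles is an integral of a function of `⌊x⌋`, so lines and sets of poles are both
instances of `WeightedPath`. One Gaussian bound then gives integrability for all of them
(`integrable_pathIntegrand`), and Fubini lets the one-variable relation be multiplied out over the
coordinates (`pathIntegral_piecewise`). In the resulting sum over subsets `v`, the poles in the
coordinates of `v` add up to the theta function (`integrable_subsetIntegrand`), and the empty set
cancels the integral over `ℝⁿ`. -/

namespace PartialTheta

/-! ### Lattice sums as Lebesgue integrals -/

section Counting

/-- The product of counting measures is the counting measure. -/
theorem pi_count_eq_count {ι α : Type*} [Fintype ι] [Countable α] [MeasurableSpace α]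
    [MeasurableSingletonClass α] :
    Measure.pi (fun _ : ι => (Measure.count : Measure α)) = Measure.count := by
  classical
  refine Measure.ext_of_singleton fun m => ?_
  rw [Measure.pi_singleton]
  simp

/-- The integer part maps Lebesgue measure to the counting measure. -/
theorem measurePreserving_floor :
    MeasurePreserving (fun x : ℝ => ⌊x⌋) volume Measure.count := by
  refine ⟨Int.measurable_floor, Measure.ext_of_singleton fun m => ?_⟩
  rw [Measure.map_apply Int.measurable_floor (measurableSet_singleton m)]
  have : (fun x : ℝ => ⌊x⌋) ⁻¹' {m} = Set.Ico (m : ℝ) (m + 1) := by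
    ext x; simp
  simp [this]

/-- The coordinatewise integer part maps Lebesgue measure to the counting measure. -/
theorem measurePreserving_floor_pi {ι : Type*} [Fintype ι] :
    MeasurePreserving (fun (x : ι → ℝ) i => ⌊x i⌋) volume Measure.count := by
  rw [← pi_count_eq_count]
  exact measurePreserving_pi _ _ fun _ => measurePreserving_floor

theorem integral_count_eq_tsum {α : Type*} [Countable α] [MeasurableSpace α]
    [MeasurableSingletonClass α] {f : α → ℂ} (hf : Summable f) :
    ∫ a, f a ∂Measure.count = ∑' a, f a := by
  rw [integral_countable (integrable_count_iff.2 hf.norm)]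
  simp

theorem integral_comp_floor_eq_tsum {ι : Type*} [Fintype ι] {f : (ι → ℤ) → ℂ}
    (hf : Summable f) : ∫ x : ι → ℝ, f (fun i => ⌊x i⌋) = ∑' m, f m := by
  rw [← integral_count_eq_tsum hf, ← measurePreserving_floor_pi.map_eq, integral_map]
  · exact measurePreserving_floor_pi.measurable.aemeasurable
  · exact (measurable_of_countable f).aestronglyMeasurable

theorem integral_comp_floor_real_eq_tsum {f : ℤ → ℂ}
    (hf : Summable f) : ∫ x : ℝ, f ⌊x⌋ = ∑' m, f m := by
  rw [← integral_count_eq_tsum hf, ← measurePreserving_floor.map_eq, integral_map]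
  · exact measurePreserving_floor.measurable.aemeasurable
  · exact (measurable_of_countable f).aestronglyMeasurable

/-- Summability is integrability for the counting measure, so this is the integrability of a product
of functions of separate variables. -/
theorem summable_pi_prod {ι α : Type*} [Fintype ι] [Countable α] {f : ι → α → ℂ}
    (hf : ∀ i, Summable (f i)) : Summable fun k : ι → α => ∏ i, f i (k i) := by
  let _ : MeasurableSpace α := ⊤
  have h := Integrable.fintype_prod (μ := fun _ : ι => (Measure.count : Measure α))
    fun i => integrable_count_iff.2 (hf i).norm
  rw [pi_count_eq_count, integrable_count_iff] at h
  exact h.of_norm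

theorem hasSum_pi_prod {ι α : Type*} [Fintype ι] [Countable α] {f : ι → α → ℂ}
    (hf : ∀ i, Summable (f i)) :
    HasSum (fun k : ι → α => ∏ i, f i (k i)) (∏ i, ∑' a, f i a) := by
  let _ : MeasurableSpace α := ⊤
  have hs := summable_pi_prod hf
  have h := integral_fintype_prod_eq_prod (μ := fun _ : ι => (Measure.count : Measure α)) f
  rw [pi_count_eq_count, integral_count_eq_tsum hs] at h
  simp_rw [fun i => integral_count_eq_tsum (hf i)] at h
  exact h ▸ hs.hasSum

end Counting

/-! ### Expansion of the cosecant and termwise integration -/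

section SineExpansion

/-- The term of the expansion of `1 / sin (π z)` in the lower half-plane. -/
noncomputable def cscTerm (z : ℂ) (k : ℕ) : ℂ :=
  2 * I * cexp (-(2 * Real.pi * I * z * (k + 1 / 2)))

theorem norm_cscTerm (z : ℂ) (k : ℕ) :
    ‖cscTerm z k‖ = 2 * Real.exp (2 * Real.pi * z.im * (k + 1 / 2)) := by
  rw [cscTerm, norm_mul, Complex.norm_exp]
  have : (-(2 * Real.pi * I * z * ((k : ℂ) + 1 / 2))).re = 2 * Real.pi * z.im * (k + 1 / 2) := by
    have : (-(2 * Real.pi * I * z * ((k : ℂ) + 1 / 2))) =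
      ((2 * Real.pi * (k + 1 / 2) : ℝ) : ℂ) * (-(I * z)) := by push_cast; ring
    rw [this, re_ofReal_mul]
    simp
    ring
  rw [this]; simp

/-- With `r = exp (-2 π i z)` one has `sin (π z) = (1 - r) exp (π i z) / (2 i)`, and `‖r‖ < 1` below
the real axis. -/
theorem hasSum_cscTerm {z : ℂ} (hz : z.im < 0) :
    HasSum (cscTerm z) (Complex.sin (Real.pi * z))⁻¹ := by
  set r : ℂ := cexp (-(2 * Real.pi * I * z)) with hr
  have hr1 : ‖r‖ < 1 := by
    rw [hr, Complex.norm_exp, Real.exp_lt_one_iff]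
    simp
    nlinarith [Real.pi_pos]
  have h := (hasSum_geometric_of_norm_lt_one hr1).mul_left (2 * I * cexp (-(Real.pi * I * z)))
  have hterm : cscTerm z = fun k => 2 * I * cexp (-(Real.pi * I * z)) * r ^ k := by
    ext k
    rw [cscTerm, hr, ← Complex.exp_nat_mul, mul_assoc (2 * I) (cexp _), ← Complex.exp_add]
    congr 2
    ring
  have hval : (Complex.sin (Real.pi * z))⁻¹ = 2 * I * cexp (-(Real.pi * I * z)) * (1 - r)⁻¹ := by
    have h1 : 1 - r ≠ 0 := by
      intro h0
      rw [sub_eq_zero] at h0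
      rw [← h0] at hr1
      simp at hr1
    have hs : Complex.sin (Real.pi * z) = (1 - r) * cexp (Real.pi * I * z) / (2 * I) := by
      have hI : (2 * I : ℂ) ≠ 0 := by simp
      rw [eq_div_iff hI, sub_mul, hr, ← Complex.exp_add, Complex.sin]
      ring_nf
      rw [I_sq]
      ring_nf
    rw [hs, Complex.exp_neg]
    field_simp
  rw [hterm, hval]
  exact h

theorem summable_norm_cscTerm {s : ℝ} (hs : s < 0) :
    Summable fun k : ℕ => 2 * Real.exp (2 * Real.pi * s * (k + 1 / 2)) := by
  have h := (hasSum_cscTerm (z := I * s) (by simpa using hs)).summable.norm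
  simpa [norm_cscTerm] using h

/-- Termwise integration of the expansion of a product of cosecants. -/
theorem hasSum_integral_mul_cscTerm {ι X : Type*} [Fintype ι] [MeasurableSpace X]
    {μ : Measure X} {ψ : X → ℂ} (hψ : Integrable ψ μ) {z : ι → X → ℂ}
    (hz : ∀ i, Measurable (z i)) {s : ι → ℝ} (hs : ∀ i, s i < 0)
    (him : ∀ i x, (z i x).im = s i) :
    HasSum (fun k : ι → ℕ => ∫ x, ψ x * ∏ i, cscTerm (z i x) (k i) ∂μ)
      (∫ x, ψ x / ∏ i, Complex.sin (Real.pi * z i x) ∂μ) := by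
  have hn : ∀ (k : ι → ℕ) x, ‖∏ i, cscTerm (z i x) (k i)‖ =
      ∏ i, (2 * Real.exp (2 * Real.pi * s i * (k i + 1 / 2))) := by
    intro k x
    simp [norm_prod, norm_cscTerm, him]
  have hsum : ∀ x, ∑' k : ι → ℕ, ψ x * ∏ i, cscTerm (z i x) (k i) =
      ψ x / ∏ i, Complex.sin (Real.pi * z i x) := by
    intro x
    have hc := fun i => hasSum_cscTerm (z := z i x) (by rw [him]; exact hs i)
    have h := (hasSum_pi_prod fun i => (hc i).summable).mul_left (ψ x)
    rw [h.tsum_eq, div_eq_mul_inv, ← Finset.prod_inv_distrib]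
    simp_rw [fun i => (hc i).tsum_eq]
  have hm : ∀ k : ι → ℕ, AEStronglyMeasurable (fun x => ∏ i, cscTerm (z i x) (k i)) μ := by
    intro k
    refine (Finset.measurable_prod _ fun i _ => ?_).aestronglyMeasurable
    unfold cscTerm
    have := hz i
    fun_prop
  -- The imaginary parts are constant, so the norm of each cosecant product does not depend on `x`;
  -- the integrals of the norms are one constant times a product of geometric terms.
  have key := hasSum_integral_of_summable_integral_norm (μ := μ)
    (F := fun (k : ι → ℕ) x => ψ x * ∏ i, cscTerm (z i x) (k i))
    (fun k => hψ.mul_bdd (c := ∏ i, (2 * Real.exp (2 * Real.pi * s i * (k i + 1 / 2)))) (hm k)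
      (Filter.Eventually.of_forall fun x => (hn k x).le)) ?_
  · simpa only [hsum] using key
  · simp_rw [norm_mul, hn, integral_mul_const]
    refine Summable.mul_left _ ?_
    have := summable_pi_prod (ι := ι) (f := fun i (k : ℕ) =>
      ((2 * Real.exp (2 * Real.pi * s i * (k + 1 / 2)) : ℝ) : ℂ))
      fun i => by exact_mod_cast summable_norm_cscTerm (hs i)
    exact_mod_cast this

theorem hasSum_integral_mul_cscTerm_single {X : Type*} [MeasurableSpace X]
    {μ : Measure X} {ψ : X → ℂ} (hψ : Integrable ψ μ) {z : X → ℂ}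
    (hz : Measurable z) {s : ℝ} (hs : s < 0) (him : ∀ x, (z x).im = s) :
    HasSum (fun k : ℕ => ∫ x, ψ x * cscTerm (z x) k ∂μ)
      (∫ x, ψ x / Complex.sin (Real.pi * z x) ∂μ) := by
  have h := hasSum_integral_mul_cscTerm (ι := Unit) hψ (z := fun _ => z) (fun _ => hz)
    (fun _ => hs) (fun _ => him)
  rw [← (Equiv.funUnique Unit ℕ).symm.hasSum_iff] at h
  simpa [Function.comp_def] using h

end SineExpansion

/-! ### Gaussians in one variable and crossing the poles -/

section OneVariable

variable {a : ℂ} (ha : a.re < 0) (b d : ℂ)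

/-- The one-variable Gaussian `exp (a z ^ 2 + b z + d)`. -/
noncomputable def gauss (a b d z : ℂ) : ℂ := cexp (a * z ^ 2 + b * z + d)

theorem gauss_add (a b d z ζ : ℂ) :
    gauss a b d (z + ζ) = gauss a (b + 2 * a * ζ) (a * ζ ^ 2 + b * ζ + d) z := by
  unfold gauss; ring_nf

theorem gauss_mul_exp (a b d c e z : ℂ) :
    gauss a b d z * cexp (c * z + e) = gauss a (b + c) (d + e) z := by
  unfold gauss; rw [← Complex.exp_add]; ring_nf

include ha

theorem integrable_gauss_line (ζ : ℂ) : Integrable fun x : ℝ => gauss a b d (x + ζ) := by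
  simp_rw [gauss_add]
  exact integrable_cexp_quadratic' ha _ _

/-- The integral of a Gaussian over a horizontal line does not depend on the line. -/
theorem integral_gauss_line (ζ : ℂ) :
    ∫ x : ℝ, gauss a b d (x + ζ) = ∫ x : ℝ, gauss a b d x := by
  have ha0 : a ≠ 0 := by rintro rfl; simp at ha
  simp_rw [gauss_add]
  unfold gauss
  rw [integral_cexp_quadratic ha, integral_cexp_quadratic ha]
  congr 2
  field_simp
  ring

/-- Poisson summation. The Fourier coefficient at `n` has frequency `-n`, which is why the sum is
reindexed by negation. -/
theorem tsum_gauss_eq_of_hasSum {S : ℂ}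
    (h : HasSum (fun k : ℤ => ∫ x : ℝ, gauss a (b + 2 * Real.pi * I * k) d x) S) :
    HasSum (fun m : ℤ => gauss a b d m) S := by
  have hF : ∀ n : ℤ, FourierTransform.fourier (fun x : ℝ => gauss a b d x) (n : ℝ) =
      ∫ x : ℝ, gauss a (b + 2 * Real.pi * I * ((-n : ℤ) : ℂ)) d x := by
    intro n
    rw [Real.fourier_real_eq_integral_exp_smul]
    refine integral_congr_ae (Filter.Eventually.of_forall fun x => ?_)
    simp only [smul_eq_mul, gauss]
    rw [← Complex.exp_add]
    congr 1
    push_cast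
    ring
  have h' :
      HasSum (fun n : ℤ => FourierTransform.fourier (fun x : ℝ => gauss a b d x) (n : ℝ)) S := by
    simp_rw [hF]
    exact (Equiv.neg ℤ).hasSum_iff (f := fun k : ℤ =>
      ∫ x : ℝ, gauss a (b + 2 * Real.pi * I * k) d x) |>.2 h
  have hO : (fun x : ℝ => gauss a b d x) =O[Filter.cocompact ℝ] fun x : ℝ => |x| ^ (-2 : ℝ) := by
    have := (cexp_neg_quadratic_isLittleO_abs_rpow_cocompact ha b (-2)).isBigO.const_mul_left
      (cexp d)
    refine this.congr_left fun x => ?_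
    rw [gauss, ← Complex.exp_add]
    ring_nf
  have hc : Continuous fun x : ℝ => gauss a b d x := by unfold gauss; fun_prop
  have hs : Summable fun m : ℤ => gauss a b d m := by
    have := summable_of_isBigO (Real.summable_abs_int_rpow one_lt_two)
      (hO.comp_tendsto Int.tendsto_coe_cofinite)
    simpa [Function.comp_def] using this
  have := Real.tsum_eq_tsum_fourier_of_rpow_decay_of_summable hc one_lt_two hO h'.summable 0
  simp only [zero_add, QuotientAddGroup.mk_zero, fourier_eval_zero, mul_one, ofReal_intCast] at this
  rw [h'.tsum_eq] at this
  exact this ▸ hs.hasSum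

/-- Moving the line of integration across the poles `m + i ε` of the cosecant. -/
theorem integral_gauss_div_sin_sub {ε : ℂ} (hε : 0 < ε.re) :
    HasSum (fun m : ℤ => 2 * I * ((-1 : ℂ) ^ m * gauss a b d (m + I * ε)))
      ((∫ x : ℝ, gauss a b d (x + I * ((2 * ε.re : ℝ) : ℂ)) /
          Complex.sin (Real.pi * (I * ε - (x + I * ((2 * ε.re : ℝ) : ℂ))))) -
        ∫ x : ℝ, gauss a b d x / Complex.sin (Real.pi * (I * ε - x))) := by
  set β : ℂ := I * ((2 * ε.re : ℝ) : ℂ) with hβ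
  -- The integral of the Gaussian times `exp (2 π i (k + 1/2) (x - i ε))`. The shifted line produces
  -- those with `k ≥ 0`; the real line, where the sine is reflected by oddness, produces those with
  -- `k < 0`.
  set c : ℤ → ℂ := fun k => ∫ x : ℝ, gauss a (b + 2 * Real.pi * I * (k + 1 / 2))
    (d + 2 * Real.pi * ε * (k + 1 / 2)) x with hc
  have hS : HasSum (fun k : ℕ => 2 * I * c k)
      (∫ x : ℝ, gauss a b d (x + β) / Complex.sin (Real.pi * (I * ε - (x + β)))) := by
    have h := hasSum_integral_mul_cscTerm_single (integrable_gauss_line ha b d β)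
      (z := fun x : ℝ => I * ε - (x + β)) (by fun_prop) (s := -ε.re) (by linarith)
      (by intro x; simp [hβ]; ring)
    convert h using 2 with k
    rw [hc]
    simp only
    rw [← integral_gauss_line ha _ _ β, ← integral_const_mul]
    refine integral_congr_ae (Filter.Eventually.of_forall fun x => ?_)
    simp only [cscTerm]
    rw [← gauss_mul_exp]
    have : (-(2 * Real.pi * I * (I * ε - (x + β)) * ((k : ℂ) + 1 / 2))) =
      2 * Real.pi * I * (k + 1 / 2) * (x + β) + 2 * Real.pi * ε * (k + 1 / 2) := by
      linear_combination (-2 * Real.pi * ε * (k + 1 / 2)) * I_sq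
    rw [this]
    push_cast
    ring
  have hT : HasSum (fun k : ℕ => 2 * I * c (-(k + 1)))
      (-∫ x : ℝ, gauss a b d x / Complex.sin (Real.pi * (I * ε - x))) := by
    have h := hasSum_integral_mul_cscTerm_single (by simpa using integrable_gauss_line ha b d 0)
      (z := fun x : ℝ => -(I * ε - x)) (by fun_prop) (s := -ε.re) (by linarith)
      (by intro x; simp)
    have e : (-∫ x : ℝ, gauss a b d x / Complex.sin (Real.pi * (I * ε - x))) =
        ∫ x : ℝ, gauss a b d x / Complex.sin (Real.pi * (-(I * ε - x))) := by
      rw [← integral_neg]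
      simp_rw [mul_neg, Complex.sin_neg, div_neg]
    rw [e]
    convert h using 2 with k
    rw [hc]
    simp only
    rw [← integral_const_mul]
    refine integral_congr_ae (Filter.Eventually.of_forall fun x => ?_)
    simp only [cscTerm]
    rw [← gauss_mul_exp]
    have : (-(2 * Real.pi * I * (-(I * ε - x)) * ((k : ℂ) + 1 / 2))) =
      2 * Real.pi * I * (((-(k + 1) : ℤ) : ℂ) + 1 / 2) * x
        + 2 * Real.pi * ε * (((-(k + 1) : ℤ) : ℂ) + 1 / 2) := by
      push_cast
      linear_combination (2 * Real.pi * ε * (k + 1 / 2)) * I_sq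
    rw [this]
    ring
  have hST := HasSum.of_nat_of_neg_add_one (f := fun k : ℤ => 2 * I * c k) hS hT
  rw [← sub_eq_add_neg] at hST
  have hc' : HasSum c ((2 * I)⁻¹ * ((∫ x : ℝ, gauss a b d (x + β) /
      Complex.sin (Real.pi * (I * ε - (x + β)))) -
        ∫ x : ℝ, gauss a b d x / Complex.sin (Real.pi * (I * ε - x)))) := by
    have := hST.mul_left (2 * I)⁻¹
    simpa only [inv_mul_cancel_left₀ (show (2 * I : ℂ) ≠ 0 by simp)] using this
  have hg : ∀ x : ℂ, gauss a b d (x + I * ε) * cexp (Real.pi * I * x + 0) =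
      gauss a (b + 2 * a * (I * ε) + Real.pi * I) (a * (I * ε) ^ 2 + b * (I * ε) + d + 0) x := by
    intro x
    rw [gauss_add, gauss_mul_exp]
  -- Moving the line to height `i ε` removes `ε` from the exponential. The half in `k + 1/2` leaves
  -- the factor `exp (π i x)`, which is `(-1)^m` at integers.
  have hP := tsum_gauss_eq_of_hasSum ha (b + 2 * a * (I * ε) + Real.pi * I)
    (a * (I * ε) ^ 2 + b * (I * ε) + d + 0) (S := _) (by
      convert hc' using 2 with k
      rw [hc]
      simp only
      symm
      rw [← integral_gauss_line ha _ _ (I * ε)]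
      refine integral_congr_ae (Filter.Eventually.of_forall fun x => ?_)
      simp only [gauss]
      congr 1
      linear_combination (2 * Real.pi * ε * (k + 1 / 2)) * I_sq)
  have := hP.mul_left (2 * I)
  rw [mul_inv_cancel_left₀ (by simp)] at this
  have hm : ∀ m : ℤ, gauss a (b + 2 * a * (I * ε) + Real.pi * I)
      (a * (I * ε) ^ 2 + b * (I * ε) + d + 0) m = (-1 : ℂ) ^ m * gauss a b d (m + I * ε) := by
    intro m
    rw [← hg, add_zero, mul_comm (gauss _ _ _ _), mul_comm (Real.pi * I : ℂ),
      Complex.exp_int_mul, Complex.exp_pi_mul_I]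
  simpa only [hm] using this

end OneVariable

/-! ### Gaussians in several variables and their decay -/

section Numerator

variable {ι : Type*} [Fintype ι]

/-- The Gaussian `q ^ ((z, B z) / 2) * exp (-2 π i (u, z))` of several variables. -/
noncomputable def numer (B : Matrix ι ι ℂ) (u : ι → ℂ) (τ : ℂ) (z : ι → ℂ) : ℂ :=
  qPow τ (1 / 2 * (z ⬝ᵥ B *ᵥ z)) * cexp (-(2 * Real.pi * I * (u ⬝ᵥ z)))

theorem numer_eq_exp (B : Matrix ι ι ℂ) (u : ι → ℂ) (τ : ℂ) (z : ι → ℂ) :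
    numer B u τ z =
      cexp (Real.pi * I * τ * (z ⬝ᵥ B *ᵥ z) - 2 * Real.pi * I * (u ⬝ᵥ z)) := by
  rw [numer, qPow, ← Complex.exp_add]
  ring_nf

theorem continuous_numer (B : Matrix ι ι ℂ) (u : ι → ℂ) (τ : ℂ) :
    Continuous (numer B u τ) := by
  unfold numer qPow dotProduct Matrix.mulVec dotProduct
  fun_prop

theorem norm_dotProduct_mulVec_le (B : Matrix ι ι ℂ) {x y : ι → ℂ} {α β : ℝ}
    (hα : 0 ≤ α) (hx : ∀ i, ‖x i‖ ≤ α) (hy : ∀ i, ‖y i‖ ≤ β) :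
    ‖x ⬝ᵥ B *ᵥ y‖ ≤ (∑ i, ∑ j, ‖B i j‖) * (α * β) := by
  simp only [dotProduct, Matrix.mulVec, Finset.mul_sum, Finset.sum_mul]
  refine (norm_sum_le _ _).trans (Finset.sum_le_sum fun i _ => (norm_sum_le _ _).trans
    (Finset.sum_le_sum fun j _ => ?_))
  rw [norm_mul, norm_mul]
  calc ‖x i‖ * (‖B i j‖ * ‖y j‖) = ‖B i j‖ * (‖x i‖ * ‖y j‖) := by ring
    _ ≤ _ := by
      have := hx i
      have := hy j
      gcongr

theorem norm_dotProduct_le (u : ι → ℂ) {x : ι → ℂ} {α : ℝ} (hx : ∀ i, ‖x i‖ ≤ α) :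
    ‖u ⬝ᵥ x‖ ≤ (∑ i, ‖u i‖) * α := by
  simp only [dotProduct, Finset.sum_mul]
  refine (norm_sum_le _ _).trans (Finset.sum_le_sum fun i _ => ?_)
  rw [norm_mul]
  have := hx i
  gcongr

open scoped MatrixOrder in
/-- A positive definite matrix is `Bᵀ B` with an invertible `B`. -/
theorem exists_transpose_mul_self [DecidableEq ι] {B : Matrix ι ι ℝ} (hB : B.PosDef) :
    ∃ N : Matrix ι ι ℝ, B = Nᵀ * N ∧ IsUnit N.det := by
  obtain ⟨N, hN⟩ := CStarAlgebra.nonneg_iff_eq_star_mul_self.1 hB.posSemidef.nonneg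
  rw [Matrix.star_eq_conjTranspose, Matrix.conjTranspose_eq_transpose_of_trivial] at hN
  refine ⟨N, hN, ?_⟩
  have := hB.det_pos.ne'
  rw [hN, Matrix.det_mul, Matrix.det_transpose] at this
  exact isUnit_iff_ne_zero.2 (left_ne_zero_of_mul this)

/-- A positive definite quadratic form dominates a multiple of the sum of squares. -/
theorem exists_pos_mul_sum_sq_le {B : Matrix ι ι ℝ} (hB : B.PosDef) :
    ∃ c : ℝ, 0 < c ∧ ∀ x : ι → ℝ, c * ∑ i, x i ^ 2 ≤ x ⬝ᵥ B *ᵥ x := by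
  classical
  obtain ⟨N, rfl, hN⟩ := exists_transpose_mul_self hB
  -- The squared Hilbert–Schmidt norm of `N⁻¹` bounds `|x|²` by `|N x|²`, by Cauchy–Schwarz; adding
  -- `1` keeps `K` positive even for empty `ι`.
  set K : ℝ := 1 + ∑ i, ∑ j, (N⁻¹) i j ^ 2 with hK
  have hK0 : 0 < K := by positivity
  refine ⟨K⁻¹, by positivity, fun x => ?_⟩
  rw [inv_mul_le_iff₀ hK0]
  have hq : x ⬝ᵥ (Nᵀ * N) *ᵥ x = ∑ j, (N *ᵥ x) j ^ 2 := by
    rw [← Matrix.mulVec_mulVec, Matrix.dotProduct_mulVec, Matrix.vecMul_transpose]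
    simp [dotProduct, sq]
  have hx : ∀ i, x i = ∑ j, (N⁻¹) i j * (N *ᵥ x) j := by
    intro i
    have : N⁻¹ *ᵥ (N *ᵥ x) = x := by
      rw [Matrix.mulVec_mulVec, Matrix.nonsing_inv_mul _ hN, Matrix.one_mulVec]
    exact (congrFun this i).symm
  rw [hq]
  calc ∑ i, x i ^ 2 ≤ ∑ i, (∑ j, (N⁻¹) i j ^ 2) * ∑ j, (N *ᵥ x) j ^ 2 := by
        refine Finset.sum_le_sum fun i _ => ?_
        conv_lhs => rw [hx i]
        exact Finset.sum_mul_sq_le_sq_mul_sq _ _ _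
    _ = (∑ i, ∑ j, (N⁻¹) i j ^ 2) * ∑ j, (N *ᵥ x) j ^ 2 := by rw [Finset.sum_mul]
    _ ≤ K * ∑ j, (N *ᵥ x) j ^ 2 := by
        have : 0 ≤ ∑ j, (N *ᵥ x) j ^ 2 := by positivity
        gcongr
        simp [hK]

theorem ofReal_dotProduct_mulVec (B : Matrix ι ι ℝ) (x y : ι → ℝ) :
    (fun i => (x i : ℂ)) ⬝ᵥ (B.map ofReal) *ᵥ (fun i => (y i : ℂ)) = ((x ⬝ᵥ B *ᵥ y : ℝ) : ℂ) := by
  simp [dotProduct, Matrix.mulVec]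

/-- Gaussian decay in tubes of bounded width around the real subspace. -/
theorem exists_norm_numer_le {B : Matrix ι ι ℝ} (hB : B.PosDef) (u : ι → ℂ) {τ : ℂ}
    (hτ : 0 < τ.im) (M : ℝ) :
    ∃ δ C : ℝ, 0 < δ ∧ 0 ≤ C ∧ ∀ z : ι → ℂ, (∀ i, |(z i).im| ≤ M) →
      ‖numer (B.map ofReal) u τ z‖ ≤ C * ∏ i, Real.exp (-δ * (z i).re ^ 2) := by
  obtain ⟨c, hc, hcB⟩ := exists_pos_mul_sum_sq_le hB
  set S : ℝ := ∑ i, ∑ j, ‖(B.map ofReal) i j‖ with hS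
  set U : ℝ := ∑ i, ‖u i‖ with hU
  -- Half of the decay rate of the real quadratic form: the other half absorbs the terms linear in
  -- the real part, at the cost of `K ^ 2 / (4 * δ)` per coordinate.
  set δ : ℝ := Real.pi * τ.im * c / 2 with hδ
  have hδ0 : 0 < δ := by have := Real.pi_pos; positivity
  set K : ℝ := Real.pi * ‖τ‖ * (2 * S * M) + 2 * Real.pi * U with hK
  set K' : ℝ := Real.pi * ‖τ‖ * (S * M ^ 2) + 2 * Real.pi * U * M with hK'
  refine ⟨δ, Real.exp (K' + ∑ _i : ι, K ^ 2 / (4 * δ)), hδ0, (Real.exp_pos _).le, fun z hz => ?_⟩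
  rw [numer_eq_exp, Complex.norm_exp, ← Real.exp_sum, ← Real.exp_add, Real.exp_le_exp]
  set x : ι → ℂ := fun i => ((z i).re : ℂ) with hx
  set y : ι → ℂ := fun i => ((z i).im : ℂ) with hy
  set X : ℝ := ∑ i, |(z i).re| with hX
  have hX0 : 0 ≤ X := by positivity
  have hxX : ∀ i, ‖x i‖ ≤ X := fun i => by
    simp only [hx, Complex.norm_real, Real.norm_eq_abs]
    exact Finset.single_le_sum (f := fun i => |(z i).re|) (fun _ _ => abs_nonneg _)
      (Finset.mem_univ i)
  have hyM : ∀ i, ‖y i‖ ≤ M := fun i => by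
    simpa only [hy, Complex.norm_real, Real.norm_eq_abs] using hz i
  have hzxy : z = x + I • y := by
    ext i
    simp [hx, hy, mul_comm I, re_add_im]
  have hexp : Real.pi * I * τ * (z ⬝ᵥ (B.map ofReal) *ᵥ z) - 2 * Real.pi * I * (u ⬝ᵥ z) =
      Real.pi * I * τ * ((((fun i => (z i).re) ⬝ᵥ B *ᵥ (fun i => (z i).re) : ℝ)) : ℂ) +
      (Real.pi * I * τ * (I * (x ⬝ᵥ (B.map ofReal) *ᵥ y) + I * (y ⬝ᵥ (B.map ofReal) *ᵥ x)
        - y ⬝ᵥ (B.map ofReal) *ᵥ y) - 2 * Real.pi * I * (u ⬝ᵥ z)) := by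
    rw [← ofReal_dotProduct_mulVec]
    conv_lhs => rw [hzxy]
    change _ = Real.pi * I * τ * (x ⬝ᵥ (B.map ofReal) *ᵥ x) + _
    simp only [Matrix.mulVec_add, Matrix.mulVec_smul, dotProduct_add, add_dotProduct,
      dotProduct_smul, smul_dotProduct, smul_eq_mul]
    conv_rhs => rw [hzxy]
    simp only [dotProduct_add, dotProduct_smul, smul_eq_mul]
    linear_combination Real.pi * I * τ * (y ⬝ᵥ (B.map ofReal) *ᵥ y) * I_sq
  have hmain : (Real.pi * I * τ * ((((fun i => (z i).re) ⬝ᵥ B *ᵥ (fun i => (z i).re) : ℝ)) : ℂ)).re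
      ≤ - ∑ i, 2 * δ * (z i).re ^ 2 := by
    have h1 : (Real.pi * I * τ * ((((fun i => (z i).re) ⬝ᵥ B *ᵥ (fun i => (z i).re) : ℝ)) : ℂ)).re
        = -(Real.pi * τ.im * ((fun i => (z i).re) ⬝ᵥ B *ᵥ (fun i => (z i).re))) := by
      simp
    rw [h1, ← Finset.mul_sum, neg_le_neg_iff]
    have := hcB (fun i => (z i).re)
    calc 2 * δ * ∑ i, (z i).re ^ 2 = Real.pi * τ.im * (c * ∑ i, (z i).re ^ 2) := by
          rw [hδ]; ring
      _ ≤ _ := by have := Real.pi_pos; gcongr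
  have hrest : (Real.pi * I * τ * (I * (x ⬝ᵥ (B.map ofReal) *ᵥ y) + I * (y ⬝ᵥ (B.map ofReal) *ᵥ x)
        - y ⬝ᵥ (B.map ofReal) *ᵥ y) - 2 * Real.pi * I * (u ⬝ᵥ z)).re ≤ K * X + K' := by
    refine (Complex.re_le_norm _).trans ((norm_sub_le _ _).trans ?_)
    -- Only a coordinate forces `0 ≤ M`, so the empty case is separate.
    rcases isEmpty_or_nonempty ι with h | ⟨⟨i₀⟩⟩
    · simp [hK, hK', hX, hS, hU, dotProduct]
    have hM : 0 ≤ M := (norm_nonneg _).trans (hyM i₀)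
    have h1 := norm_dotProduct_mulVec_le (B.map ofReal) hX0 hxX hyM
    have h2 := norm_dotProduct_mulVec_le (B.map ofReal) hM hyM hxX
    have h3 := norm_dotProduct_mulVec_le (B.map ofReal) hM hyM hyM
    have h4 := norm_dotProduct_le u (x := z) (α := X + M) fun i => by
      rw [hzxy]
      refine (norm_add_le _ _).trans (add_le_add (hxX i) ?_)
      simpa using hyM i
    rw [← hS] at h1 h2 h3
    rw [← hU] at h4
    have h5 : ‖I * (x ⬝ᵥ (B.map ofReal) *ᵥ y) + I * (y ⬝ᵥ (B.map ofReal) *ᵥ x)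
        - y ⬝ᵥ (B.map ofReal) *ᵥ y‖ ≤ S * (X * M) + S * (M * X) + S * (M * M) := by
      refine (norm_sub_le _ _).trans (add_le_add ((norm_add_le _ _).trans (add_le_add ?_ ?_)) h3)
      · simpa using h1
      · simpa using h2
    simp only [norm_mul, norm_I, mul_one, Complex.norm_real, Real.norm_eq_abs,
      abs_of_pos Real.pi_pos, Complex.norm_ofNat]
    calc Real.pi * ‖τ‖ * _ + 2 * Real.pi * _
        ≤ Real.pi * ‖τ‖ * (S * (X * M) + S * (M * X) + S * (M * M)) +
          2 * Real.pi * (U * (X + M)) := by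
          have := Real.pi_pos
          gcongr
      _ = K * X + K' := by rw [hK, hK']; ring
  have hKX : K * X ≤ ∑ i, (δ * (z i).re ^ 2 + K ^ 2 / (4 * δ)) := by
    rw [hX, Finset.mul_sum]
    refine Finset.sum_le_sum fun i _ => ?_
    rw [← sq_abs (z i).re]
    have : 0 ≤ (2 * δ * |(z i).re| - K) ^ 2 / (4 * δ) := by positivity
    have e : (2 * δ * |(z i).re| - K) ^ 2 / (4 * δ) =
      δ * |(z i).re| ^ 2 + K ^ 2 / (4 * δ) - K * |(z i).re| := by field_simp; ring
    linarith
  rw [hexp, add_re]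
  rw [Finset.sum_add_distrib, ← Finset.mul_sum] at hKX
  rw [← Finset.mul_sum] at hmain ⊢
  linarith

end Numerator

/-! ### Weighted paths and integrability -/

/-- A parametrized path of integration in one complex variable, with a weight. -/
structure WeightedPath where
  /-- the point of `ℂ` with the given parameter -/
  pt : ℝ → ℂ
  /-- the weight at the given parameter -/
  wt : ℝ → ℂ
  measurable_pt : Measurable pt
  measurable_wt : Measurable wt
  /-- a bound for the weight and for the distance of the path to the real axis -/
  bound : ℝ
  abs_im_pt_le : ∀ x, |(pt x).im| ≤ bound
  abs_re_pt_sub_le : ∀ x, |(pt x).re - x| ≤ bound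
  norm_wt_le : ∀ x, ‖wt x‖ ≤ bound

section Integrability

variable {ι : Type*} [Fintype ι]

/-- The integrand of a several-variable Gaussian over a product of weighted paths. -/
noncomputable def pathIntegrand (B : Matrix ι ι ℂ) (u : ι → ℂ) (τ : ℂ) (D : ι → WeightedPath)
    (x : ι → ℝ) : ℂ :=
  numer B u τ (fun i => (D i).pt (x i)) * ∏ i, (D i).wt (x i)

/-- The integral of a several-variable Gaussian over a product of weighted paths. -/
noncomputable def pathIntegral (B : Matrix ι ι ℂ) (u : ι → ℂ) (τ : ℂ)
    (D : ι → WeightedPath) : ℂ :=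
  ∫ x : ι → ℝ, pathIntegrand B u τ D x

/-- Transfers Gaussian decay in the real part of a path to decay in its parameter, at half the rate.
-/
theorem sq_half_sub_sq_le {x y R : ℝ} (h : |y - x| ≤ R) : x ^ 2 / 2 - R ^ 2 ≤ y ^ 2 := by
  have h1 : (y - x) ^ 2 ≤ R ^ 2 := by
    rw [← sq_abs]; gcongr
  nlinarith [sq_nonneg (2 * y - x)]

/-- Bounded weights and points at bounded distance from their parameters leave a product of
one-variable Gaussians as majorant. The integrals over lines, the theta series and the mixed
integrals all get their convergence from here. -/
theorem integrable_pathIntegrand {B : Matrix ι ι ℝ} (hB : B.PosDef) (u : ι → ℂ) {τ : ℂ}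
    (hτ : 0 < τ.im) (D : ι → WeightedPath) :
    Integrable (pathIntegrand (B.map ofReal) u τ D) := by
  obtain ⟨δ, C, hδ, hC, hb⟩ := exists_norm_numer_le hB u hτ (∑ i, |(D i).bound|)
  have hle : ∀ i, (D i).bound ≤ ∑ i, |(D i).bound| := fun i =>
    (le_abs_self _).trans (Finset.single_le_sum (f := fun i => |(D i).bound|)
      (fun _ _ => abs_nonneg _) (Finset.mem_univ i))
  have hint : Integrable fun x : ι → ℝ => C * ∏ i, (Real.exp (-(δ / 2) * x i ^ 2) *
      (Real.exp (δ * (D i).bound ^ 2) * (D i).bound)) := by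
    refine Integrable.const_mul (Integrable.fintype_prod
      (f := fun i y => Real.exp (-(δ / 2) * y ^ 2) *
      (Real.exp (δ * (D i).bound ^ 2) * (D i).bound)) fun i => ?_) _
    exact (integrable_exp_neg_mul_sq (by positivity)).mul_const _
  refine hint.mono' ?_ (Filter.Eventually.of_forall fun x => ?_)
  · have h1 : Measurable fun x : ι → ℝ => fun i => (D i).pt (x i) :=
      measurable_pi_lambda _ fun i => (D i).measurable_pt.comp (measurable_pi_apply i)
    have h2 : Measurable fun x : ι → ℝ => ∏ i, (D i).wt (x i) :=
      Finset.measurable_prod _ fun i _ => (D i).measurable_wt.comp (measurable_pi_apply i)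
    exact (((continuous_numer _ _ _).measurable.comp h1).mul h2).aestronglyMeasurable
  · rw [pathIntegrand, norm_mul, norm_prod]
    refine (mul_le_mul_of_nonneg_right (hb _ fun i => ((D i).abs_im_pt_le _).trans (hle i))
      (by positivity)).trans ?_
    rw [mul_assoc, ← Finset.prod_mul_distrib]
    refine mul_le_mul_of_nonneg_left (Finset.prod_le_prod (fun _ _ => by positivity)
      fun i _ => ?_) hC
    rw [← mul_assoc, ← Real.exp_add]
    refine mul_le_mul (Real.exp_le_exp.2 ?_) ((D i).norm_wt_le _) (norm_nonneg _)
      (Real.exp_pos _).le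
    have := sq_half_sub_sq_le ((D i).abs_re_pt_sub_le (x i))
    nlinarith

end Integrability

/-! ### Multiplying out one-variable relations -/

section Expansion

/-- `S` equals `T + κ R` as functionals on one-variable Gaussians. -/
def GaussRelation (S T R : WeightedPath) (κ : ℂ) : Prop :=
  ∀ a b d : ℂ, a.re < 0 → ∫ x, gauss a b d (S.pt x) * S.wt x =
    (∫ x, gauss a b d (T.pt x) * T.wt x) + κ * ∫ x, gauss a b d (R.pt x) * R.wt x

/-- As a function of one coordinate, a Gaussian of several variables is a Gaussian. -/
theorem exists_numer_insertNth_eq_gauss {n : ℕ} {B : Matrix (Fin (n + 1)) (Fin (n + 1)) ℝ}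
    (hB : B.PosDef) (u : Fin (n + 1) → ℂ) {τ : ℂ} (hτ : 0 < τ.im) (j : Fin (n + 1))
    (y : Fin n → ℂ) :
    ∃ a b d : ℂ, a.re < 0 ∧ ∀ z, numer (B.map ofReal) u τ (j.insertNth z y) = gauss a b d z := by
  set B' := B.map (ofReal : ℝ → ℂ) with hB'
  set y₀ : Fin (n + 1) → ℂ := j.insertNth 0 y
  set e : Fin (n + 1) → ℂ := Pi.single j 1
  refine ⟨Real.pi * I * τ * (B j j : ℂ), Real.pi * I * τ * (y₀ ⬝ᵥ B' *ᵥ e + e ⬝ᵥ B' *ᵥ y₀)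
    - 2 * Real.pi * I * (u ⬝ᵥ e), Real.pi * I * τ * (y₀ ⬝ᵥ B' *ᵥ y₀)
    - 2 * Real.pi * I * (u ⬝ᵥ y₀), ?_, fun z => ?_⟩
  · have : (Real.pi * I * τ * (B j j : ℂ)).re = -(Real.pi * τ.im * B j j) := by simp
    rw [this, neg_lt_zero]
    have := hB.diag_pos (i := j)
    have := Real.pi_pos
    positivity
  · have hz : (j.insertNth z y : Fin (n + 1) → ℂ) = y₀ + z • e := by
      ext i
      refine Fin.succAboveCases j ?_ (fun k => ?_) i
      · simp [y₀, e]
      · simp [y₀, e]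
    have hjj : (B j j : ℂ) = e ⬝ᵥ B' *ᵥ e := by simp [e, hB']
    rw [numer_eq_exp, gauss, hz, hjj]
    simp only [Matrix.mulVec_add, Matrix.mulVec_smul, dotProduct_add, add_dotProduct,
      dotProduct_smul, smul_dotProduct, smul_eq_mul]
    ring_nf

theorem pathIntegral_eq_iterated {n : ℕ} {B : Matrix (Fin (n + 1)) (Fin (n + 1)) ℝ}
    (hB : B.PosDef) (u : Fin (n + 1) → ℂ) {τ : ℂ} (hτ : 0 < τ.im)
    (D : Fin (n + 1) → WeightedPath) (j : Fin (n + 1)) :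
    Integrable (fun y : Fin n → ℝ => ∫ t : ℝ, pathIntegrand (B.map ofReal) u τ D
      (j.insertNth t y)) ∧
    pathIntegral (B.map ofReal) u τ D =
      ∫ y : Fin n → ℝ, ∫ t : ℝ, pathIntegrand (B.map ofReal) u τ D (j.insertNth t y) := by
  have hmp := (volume_preserving_piFinSuccAbove (fun _ : Fin (n + 1) => ℝ) j).symm
  have hint := (hmp.integrable_comp_emb (MeasurableEquiv.measurableEmbedding _)).2
    (integrable_pathIntegrand hB u hτ D)
  refine ⟨hint.integral_prod_right, ?_⟩
  rw [pathIntegral, ← hmp.integral_comp']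
  exact integral_prod_symm _ hint

/-- With the other coordinates fixed the integrand is a one-variable Gaussian times a constant, so
the relation holds for the inner integral and Fubini carries it outside. -/
theorem pathIntegral_update {n : ℕ} {B : Matrix (Fin n) (Fin n) ℝ}
    (hB : B.PosDef) (u : Fin n → ℂ) {τ : ℂ} (hτ : 0 < τ.im)
    (D : Fin n → WeightedPath) (j : Fin n) {S T R : WeightedPath} {κ : ℂ}
    (h : GaussRelation S T R κ) :
    pathIntegral (B.map ofReal) u τ (Function.update D j S) =
      pathIntegral (B.map ofReal) u τ (Function.update D j T) +
        κ * pathIntegral (B.map ofReal) u τ (Function.update D j R) := by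
  obtain _ | n := n
  · exact j.elim0
  obtain ⟨-, eS⟩ := pathIntegral_eq_iterated hB u hτ (Function.update D j S) j
  obtain ⟨iT, eT⟩ := pathIntegral_eq_iterated hB u hτ (Function.update D j T) j
  obtain ⟨iR, eR⟩ := pathIntegral_eq_iterated hB u hτ (Function.update D j R) j
  rw [eS, eT, eR, ← integral_const_mul, ← integral_add iT (iR.const_mul κ)]
  congr 1
  ext y
  obtain ⟨a, b, d, ha, hg⟩ := exists_numer_insertNth_eq_gauss hB u hτ j
    (fun i => (D (j.succAbove i)).pt (y i))
  have key : ∀ (P : WeightedPath), ∫ t : ℝ, pathIntegrand (B.map ofReal) u τ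
      (Function.update D j P) (j.insertNth t y) =
      (∫ t : ℝ, gauss a b d (P.pt t) * P.wt t) * ∏ i, (D (j.succAbove i)).wt (y i) := by
    intro P
    rw [← integral_mul_const]
    congr 1
    ext t
    rw [pathIntegrand, Fin.prod_univ_succAbove _ j, ← hg]
    have : (fun i => (Function.update D j P i).pt ((j.insertNth t y : Fin (n + 1) → ℝ) i)) =
        j.insertNth (P.pt t) (fun i => (D (j.succAbove i)).pt (y i)) := by
      ext i
      refine Fin.succAboveCases j ?_ (fun k => ?_) i <;> simp
    rw [this]
    simp [mul_assoc]
  rw [key, key, key, h a b d ha]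
  ring

/-- Expansion of the integral over a product of sums of weighted paths. -/
theorem pathIntegral_piecewise {n : ℕ} {B : Matrix (Fin n) (Fin n) ℝ}
    (hB : B.PosDef) (u : Fin n → ℂ) {τ : ℂ} (hτ : 0 < τ.im)
    {S T R : Fin n → WeightedPath} {κ : Fin n → ℂ}
    (h : ∀ j, GaussRelation (S j) (T j) (R j) (κ j)) (s : Finset (Fin n))
    (D : Fin n → WeightedPath) :
    pathIntegral (B.map ofReal) u τ (s.piecewise S D) =
      ∑ v ∈ s.powerset, (∏ j ∈ v, κ j) *
        pathIntegral (B.map ofReal) u τ (v.piecewise R (s.piecewise T D)) := by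
  -- The new coordinate is stored in the default family `D`, updated by `T j` or by `R j`; the two
  -- cases are the subsets without and with `j`.
  induction s using Finset.induction_on generalizing D with
  | empty => simp
  | insert j s hj ih =>
    have hne : ∀ {v : Finset (Fin n)}, v ∈ s.powerset → j ∉ v := fun hv hjv =>
      hj (Finset.mem_powerset.1 hv hjv)
    have e1 : (insert j s).piecewise S D = Function.update (s.piecewise S D) j (S j) :=
      Finset.piecewise_insert _ _ _ _
    have hup : ∀ {v : Finset (Fin n)}, j ∉ v → ∀ (f g : Fin n → WeightedPath) (P : WeightedPath),
        v.piecewise f (Function.update g j P) = Function.update (v.piecewise f g) j P := by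
      intro v hv f g P
      funext i
      by_cases hi : i = j
      · subst hi; simp [hv]
      · by_cases hiv : i ∈ v <;> simp [hi, hiv]
    have e2 : ∑ v ∈ s.powerset, (∏ i ∈ v, κ i) * pathIntegral (B.map ofReal) u τ
        (v.piecewise R (s.piecewise T (Function.update D j (T j)))) =
        ∑ v ∈ s.powerset, (∏ i ∈ v, κ i) * pathIntegral (B.map ofReal) u τ
        (v.piecewise R ((insert j s).piecewise T D)) := by
      rw [hup hj, Finset.piecewise_insert]
    have e3 : κ j * ∑ v ∈ s.powerset, (∏ i ∈ v, κ i) * pathIntegral (B.map ofReal) u τ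
        (v.piecewise R (s.piecewise T (Function.update D j (R j)))) =
        ∑ v ∈ s.powerset, (∏ i ∈ insert j v, κ i) * pathIntegral (B.map ofReal) u τ
        ((insert j v).piecewise R ((insert j s).piecewise T D)) := by
      rw [Finset.mul_sum]
      refine Finset.sum_congr rfl fun v hv => ?_
      rw [Finset.prod_insert (hne hv), ← mul_assoc, Finset.piecewise_insert,
        Finset.piecewise_insert, hup hj, hup (hne hv), hup (hne hv), Function.update_idem]
    rw [e1, pathIntegral_update hB u hτ _ j (h j), ← hup hj, ← hup hj, ih, ih, e2, e3,
      Finset.sum_powerset_insert hj]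

end Expansion

/-! ### Lines, poles and the relation between them -/

section Paths

/-- A bound for the cosecant on the horizontal lines at distance `|s|` from the real axis. -/
noncomputable def cscBound (s : ℝ) : ℝ := ∑' k : ℕ, 2 * Real.exp (2 * Real.pi * -|s| * (k + 1 / 2))

theorem cscBound_nonneg (s : ℝ) : 0 ≤ cscBound s := tsum_nonneg fun _ => by positivity

/-- Below the real axis this is the norm of the cosecant series summed termwise; above it, the sine
is odd. -/
theorem norm_inv_sin_le {z : ℂ} (hz : z.im ≠ 0) :
    ‖(Complex.sin (Real.pi * z))⁻¹‖ ≤ cscBound z.im := by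
  have key : ∀ {z : ℂ}, z.im < 0 → ‖(Complex.sin (Real.pi * z))⁻¹‖ ≤ cscBound z.im := by
    intro z hz
    have h := hasSum_cscTerm hz
    rw [← h.tsum_eq]
    refine (norm_tsum_le_tsum_norm h.summable.norm).trans (le_of_eq ?_)
    simp_rw [norm_cscTerm, cscBound, abs_of_neg hz, neg_neg]
  rcases lt_or_gt_of_ne hz with h | h
  · exact key h
  · have := key (z := -z) (by simpa using h)
    rw [mul_neg, Complex.sin_neg, inv_neg, norm_neg] at this
    simpa [cscBound] using this

/-- The horizontal line with imaginary part `α`, weighted by the cosecant. -/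
noncomputable def linePath (ε : ℂ) (α : ℝ) (h : ε.re ≠ α) : WeightedPath where
  pt x := x + I * α
  wt x := (Complex.sin (Real.pi * (I * ε - (x + I * α))))⁻¹
  measurable_pt := by fun_prop
  measurable_wt := by fun_prop
  bound := |α| + cscBound (ε.re - α)
  abs_im_pt_le x := by simpa using cscBound_nonneg _
  abs_re_pt_sub_le x := by simpa using add_nonneg (abs_nonneg α) (cscBound_nonneg _)
  norm_wt_le x := by
    have him : (I * ε - (x + I * α)).im = ε.re - α := by simp
    have := norm_inv_sin_le (z := I * ε - (x + I * α)) (by rw [him]; exact sub_ne_zero.2 h)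
    rw [him] at this
    exact this.trans (le_add_of_nonneg_left (abs_nonneg α))

/-- The points `m + i ε`, `m ∈ ℤ`, with alternating weights. -/
noncomputable def residuePath (ε : ℂ) : WeightedPath where
  pt x := ⌊x⌋ + I * ε
  wt x := (-1 : ℂ) ^ ⌊x⌋
  measurable_pt := by
    have : Measurable fun m : ℤ => (m : ℂ) + I * ε := measurable_of_countable _
    exact this.comp Int.measurable_floor
  measurable_wt := by
    have : Measurable fun m : ℤ => (-1 : ℂ) ^ m := measurable_of_countable _
    exact this.comp Int.measurable_floor
  bound := 1 + ‖ε‖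
  abs_im_pt_le x := by
    have := Complex.abs_re_le_norm ε
    simp only [add_im, intCast_im, mul_im, I_re, zero_mul, I_im, one_mul, zero_add]
    linarith
  abs_re_pt_sub_le x := by
    have h1 := Complex.abs_im_le_norm ε
    have h2 := Int.floor_le x
    have h3 := Int.lt_floor_add_one x
    simp only [add_re, intCast_re, mul_re, I_re, zero_mul, I_im, one_mul, zero_sub]
    rw [abs_le] at h1 ⊢
    constructor <;> linarith
  norm_wt_le x := by
    rw [norm_zpow, norm_neg, norm_one, one_zpow]
    simp

/-- The difference of the integrals over the shifted and the real line, in one variable. -/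
theorem gaussRelation_line {ε : ℂ} (hε : ε.re ≠ 0) {α : ℝ}
    (hα : α = (1 + Real.sign ε.re) * ε.re) (h : ε.re ≠ α) :
    GaussRelation (linePath ε α h) (linePath ε 0 hε) (residuePath ε)
      (I * (1 + (Real.sign ε.re : ℂ))) := by
  intro a b d ha
  rcases lt_or_gt_of_ne hε with hneg | hpos
  -- The two lines coincide and the coefficient of the pole term vanishes.
  · have h0 : α = 0 := by rw [hα, Real.sign_of_neg hneg]; ring
    subst h0
    simp [Real.sign_of_neg hneg]
  · rw [Real.sign_of_pos hpos] at hα ⊢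
    have h2 : α = 2 * ε.re := by rw [hα]; ring
    subst h2
    have hs := integral_gauss_div_sin_sub ha b d hpos
    have hs' : Summable fun m : ℤ => gauss a b d (m + I * ε) * (-1 : ℂ) ^ m := by
      have := hs.summable.mul_left (2 * I)⁻¹
      simp_rw [inv_mul_cancel_left₀ (show (2 * I : ℂ) ≠ 0 by simp)] at this
      simpa only [mul_comm] using this
    have hR : ∫ x, gauss a b d ((residuePath ε).pt x) * (residuePath ε).wt x =
        ∑' m : ℤ, gauss a b d (m + I * ε) * (-1 : ℂ) ^ m :=
      integral_comp_floor_real_eq_tsum hs'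
    rw [hR]
    have := hs.tsum_eq
    rw [tsum_mul_left] at this
    simp_rw [mul_comm ((-1 : ℂ) ^ (_ : ℤ))] at this
    have e : I * (1 + ((1 : ℝ) : ℂ)) = 2 * I := by push_cast; ring
    rw [e, this]
    simp only [linePath, div_eq_mul_inv, ofReal_zero, mul_zero, add_zero]
    ring

/-- This inequality is the purpose of `α`: it puts `i ε_j - w_j` into the lower half-plane for
either sign of `Re ε_j`. -/
theorem lt_shiftVector {n : ℕ} {ε : Fin n → ℂ} (hε : ∀ j, (ε j).re ≠ 0) (j : Fin n) :
    (ε j).re < shiftVector ε j := by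
  rw [shiftVector]
  rcases lt_or_gt_of_ne (hε j) with h | h
  · rw [Real.sign_of_neg h]; simpa using h
  · rw [Real.sign_of_pos h]; linarith

theorem shiftVector_ne {n : ℕ} {ε : Fin n → ℂ} (hε : ∀ j, (ε j).re ≠ 0) (j : Fin n) :
    (ε j).re ≠ shiftVector ε j :=
  (lt_shiftVector hε j).ne

end Paths

/-! ### Convergence of the theta series -/

section Theta

theorem neg_one_zpow_sum {ι : Type*} (s : Finset ι) (m : ι → ℤ) :
    (-1 : ℂ) ^ (∑ i ∈ s, m i) = ∏ i ∈ s, (-1 : ℂ) ^ m i := by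
  classical
  induction s using Finset.induction_on with
  | empty => simp
  | insert i s hi ih => rw [Finset.sum_insert hi, Finset.prod_insert hi, zpow_add₀ (by simp), ih]

variable {ι : Type*} [Fintype ι]

theorem thetaTerm_eq_numer (B : Matrix ι ι ℂ) (ε u : ι → ℂ) (τ : ℂ) (m : ι → ℤ) :
    thetaTerm B ε u τ m =
      numer B (-u) τ (fun i => (m i : ℂ) + I * ε i) * ∏ i, (-1 : ℂ) ^ m i := by
  rw [← neg_one_zpow_sum]
  simp only [thetaTerm, numer, neg_dotProduct, mul_neg, neg_neg]
  ring

/-- The integrand over a product of pole paths is the theta term composed with the integer part, so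
its integrability is the summability sought. -/
theorem summable_thetaTerm {B : Matrix ι ι ℝ} (hB : B.PosDef) (ε u : ι → ℂ) {τ : ℂ}
    (hτ : 0 < τ.im) : Summable (thetaTerm (B.map ofReal) ε u τ) := by
  have h := integrable_pathIntegrand hB (-u) hτ fun i => residuePath (ε i)
  have e : pathIntegrand (B.map ofReal) (-u) τ (fun i => residuePath (ε i)) =
      thetaTerm (B.map ofReal) ε u τ ∘ fun (x : ι → ℝ) i => ⌊x i⌋ := by
    ext x
    simp only [Function.comp_apply, thetaTerm_eq_numer]
    rfl
  rw [e, measurePreserving_floor_pi.integrable_comp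
    (measurable_of_countable _).aestronglyMeasurable, integrable_count_iff] at h
  exact h.of_norm

end Theta

/-! ### The complex matrix and its inverse -/

section Inverse

variable {n : ℕ} {A : Matrix (Fin n) (Fin n) ℤ}

theorem toC_eq_map : toC A = (A.map (fun a => (a : ℝ))).map ofReal := by
  ext i j; simp [toC]

theorem toC_inv_eq_map (hA : (A.map (fun a => (a : ℝ))).PosDef) :
    (toC A)⁻¹ = ((A.map (fun a => (a : ℝ)))⁻¹).map ofReal := by
  rw [toC_eq_map]
  refine Matrix.inv_eq_right_inv ?_
  have h := Matrix.mul_nonsing_inv _ hA.det_pos.ne'.isUnit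
  have h' := congrArg (fun M : Matrix (Fin n) (Fin n) ℝ => M.map ofRealHom) h
  simp only [Matrix.map_mul, Matrix.map_one _ ofRealHom.map_zero ofRealHom.map_one] at h'
  exact h'

theorem isUnit_det_toC (hA : (A.map (fun a => (a : ℝ))).PosDef) : IsUnit (toC A).det := by
  have h : (toC A).det = (((A.map (fun a => (a : ℝ))).det : ℝ) : ℂ) := by
    rw [toC_eq_map]
    exact (RingHom.map_det ofRealHom _).symm
  rw [h]
  exact (ofReal_ne_zero.2 hA.det_pos.ne').isUnit

theorem toC_transpose (hA : (A.map (fun a => (a : ℝ))).PosDef) : (toC A)ᵀ = toC A := by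
  have h : (A.map (fun a => (a : ℝ)))ᵀ = A.map (fun a => (a : ℝ)) := by
    simpa [Matrix.IsHermitian] using hA.1
  rw [toC_eq_map, ← Matrix.transpose_map, h]

theorem toC_inv_transpose (hA : (A.map (fun a => (a : ℝ))).PosDef) :
    ((toC A)⁻¹)ᵀ = (toC A)⁻¹ := by
  rw [Matrix.transpose_nonsing_inv, toC_transpose hA]

theorem dotProduct_mulVec_comm_of_transpose_eq {ι : Type*} [Fintype ι] {M : Matrix ι ι ℂ}
    (hM : Mᵀ = M) (x y : ι → ℂ) : x ⬝ᵥ M *ᵥ y = y ⬝ᵥ M *ᵥ x := by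
  rw [Matrix.dotProduct_mulVec, ← Matrix.mulVec_transpose, hM, dotProduct_comm]

end Inverse

/-! ### Integrals over translated real subspaces -/

section Lines

variable {n : ℕ} {A : Matrix (Fin n) (Fin n) ℤ}

variable {ε : Fin n → ℂ} {α : Fin n → ℝ} (hα : ∀ j, (ε j).re ≠ α j) (u : Fin n → ℂ) (τ : ℂ)

theorem integrand_shiftedPoint_eq_pathIntegrand (w : Fin n → ℝ) :
    integrand A ε u τ (shiftedPoint α w) =
      pathIntegrand (toC A)⁻¹ u τ (fun j => linePath (ε j) (α j) (hα j)) w := by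
  rw [integrand, div_eq_mul_inv, ← Finset.prod_inv_distrib]
  rfl

theorem planeIntegral_eq_pathIntegral :
    planeIntegral α (integrand A ε u τ) =
      pathIntegral (toC A)⁻¹ u τ (fun j => linePath (ε j) (α j) (hα j)) := by
  unfold planeIntegral pathIntegral
  simp_rw [integrand_shiftedPoint_eq_pathIntegrand hα]

include hα in
theorem integrable_integrand_shiftedPoint (hA : (A.map (fun a => (a : ℝ))).PosDef)
    {τ : ℂ} (hτ : 0 < τ.im) :
    Integrable fun w : Fin n → ℝ => integrand A ε u τ (shiftedPoint α w) := by
  simp_rw [integrand_shiftedPoint_eq_pathIntegrand hα, toC_inv_eq_map hA]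
  exact integrable_pathIntegrand hA.inv u hτ _

end Lines

/-! ### Theta functions from subsets of coordinates -/

section Subsets

variable {n : ℕ} {A : Matrix (Fin n) (Fin n) ℤ}

/-- Splitting the coordinates of `ℝⁿ` in two groups preserves Lebesgue measure, for any choice of
the instance that says that the first group is finite. -/
theorem volume_preserving_splitCoordinates (p : Fin n → Prop) [DecidablePred p]
    [inst : Fintype {i // p i}] :
    MeasurePreserving (MeasurableEquiv.piEquivPiSubtypeProd (fun _ : Fin n => ℝ) p)
      volume ((volume : Measure ({i // p i} → ℝ)).prod (volume : Measure ({i // ¬p i} → ℝ))) := by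
  obtain rfl : inst = Subtype.fintype p := Subsingleton.elim _ _
  exact volume_preserving_piEquivPiSubtypeProd (fun _ : Fin n => ℝ) p

variable (v : Finset (Fin n))

/-- The vector of `ℂⁿ` whose coordinates in `v` are those of `x`, the others vanish. -/
noncomputable def extendZeroOn (x : {i // i ∈ v} → ℂ) : Fin n → ℂ :=
  fun i => if h : i ∈ v then x ⟨i, h⟩ else 0

theorem dotProduct_extendZeroOn (y : Fin n → ℂ) (x : {i // i ∈ v} → ℂ) :
    y ⬝ᵥ extendZeroOn v x = (fun i : {i // i ∈ v} => y i) ⬝ᵥ x := by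
  simp only [dotProduct]
  rw [← Finset.sum_subset (Finset.subset_univ v) fun i _ hi => by simp [extendZeroOn, hi],
    ← Finset.sum_coe_sort]
  exact Finset.sum_congr rfl fun i _ => by simp [extendZeroOn]

theorem mulVec_extendZeroOn (M : Matrix (Fin n) (Fin n) ℂ) (x : {i // i ∈ v} → ℂ)
    (i : {i // i ∈ v}) :
    (M *ᵥ extendZeroOn v x) i = (M.submatrix Subtype.val Subtype.val *ᵥ x) i :=
  dotProduct_extendZeroOn v (M i) x

/-- Splitting off the coordinates in `v` from the Gaussian. -/
theorem numer_extendZero_add (hA : (A.map (fun a => (a : ℝ))).PosDef) (u : Fin n → ℂ) (τ : ℂ)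
    (w : {i // i ∉ v} → ℝ) (x : {i // i ∈ v} → ℂ) :
    numer (toC A)⁻¹ u τ (extendZero v w + extendZeroOn v x) =
      numer (subInverse A v) (-thetaArgument A v u τ w) τ x *
        numer (toC A)⁻¹ u τ (extendZero v w) := by
  have h1 : extendZeroOn v x ⬝ᵥ (toC A)⁻¹ *ᵥ extendZeroOn v x = x ⬝ᵥ subInverse A v *ᵥ x := by
    rw [dotProduct_comm, dotProduct_extendZeroOn, dotProduct_comm]
    simp_rw [mulVec_extendZeroOn]
    rfl
  have h2 : extendZeroOn v x ⬝ᵥ (toC A)⁻¹ *ᵥ extendZero v w = crossVector A v w ⬝ᵥ x := by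
    rw [dotProduct_comm, dotProduct_extendZeroOn]
    rfl
  -- By symmetry the cross term occurs twice; together with the linear term in `u` it forms the
  -- elliptic argument of the theta function.
  have h3 : thetaArgument A v u τ w ⬝ᵥ x =
      τ * (crossVector A v w ⬝ᵥ x) - u ⬝ᵥ extendZeroOn v x := by
    rw [dotProduct_extendZeroOn]
    simp only [thetaArgument, dotProduct, sub_mul, Finset.sum_sub_distrib, Finset.mul_sum]
    congr 1
    exact Finset.sum_congr rfl fun i _ => by ring
  simp only [numer_eq_exp]
  rw [← Complex.exp_add]
  congr 1
  simp only [Matrix.mulVec_add, dotProduct_add, add_dotProduct, neg_dotProduct]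
  rw [dotProduct_mulVec_comm_of_transpose_eq (toC_inv_transpose hA) (extendZero v w)
    (extendZeroOn v x), h1, h2, h3]
  ring

variable {ε : Fin n → ℂ} (hε : ∀ j, (ε j).re ≠ 0)

/-- The paths of integration that belong to the subset `v`: the poles for the coordinates in `v`,
the real line for the others. -/
noncomputable def subsetPaths : Fin n → WeightedPath :=
  v.piecewise (fun j => residuePath (ε j)) (fun j => linePath (ε j) 0 (hε j))

/-- The factor of the integrand of `I^{(v)}` besides the theta function. -/
noncomputable def subsetFactor (A : Matrix (Fin n) (Fin n) ℤ) (ε u : Fin n → ℂ) (τ : ℂ)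
    (w : {i // i ∉ v} → ℝ) : ℂ :=
  numer (toC A)⁻¹ u τ (extendZero v w) /
    ∏ j : {i // i ∉ v}, Complex.sin (Real.pi * (I * ε j - w j))

/-- The coordinates in `v` enter only through their integer parts, so integrating them out sums the
theta series. -/
theorem pathIntegrand_subsetPaths (hA : (A.map (fun a => (a : ℝ))).PosDef) (u : Fin n → ℂ) (τ : ℂ)
    (y : {i // i ∈ v} → ℝ) (w : {i // i ∉ v} → ℝ) :
    pathIntegrand (toC A)⁻¹ u τ (subsetPaths v hε)
        ((MeasurableEquiv.piEquivPiSubtypeProd (fun _ : Fin n => ℝ) (· ∈ v)).symm (y, w)) =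
      thetaTerm (subInverse A v) (restrict v ε) (thetaArgument A v u τ w) τ (fun i => ⌊y i⌋) *
        subsetFactor v A ε u τ w := by
  set x := (MeasurableEquiv.piEquivPiSubtypeProd (fun _ : Fin n => ℝ) (· ∈ v)).symm (y, w) with hx
  have hxv : ∀ i : {i // i ∈ v}, x i = y i := fun i => by
    simp [hx, MeasurableEquiv.piEquivPiSubtypeProd, Equiv.piEquivPiSubtypeProd]
  have hxw : ∀ i : {i // i ∉ v}, x i = w i := fun i => by
    simp [hx, MeasurableEquiv.piEquivPiSubtypeProd, Equiv.piEquivPiSubtypeProd, i.2]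
  have hpt : (fun i => (subsetPaths v hε i).pt (x i)) = extendZero v w +
      extendZeroOn v (fun i => (⌊y i⌋ : ℂ) + I * restrict v ε i) := by
    ext i
    by_cases hi : i ∈ v
    · simp [subsetPaths, extendZero, extendZeroOn, hi, residuePath, restrict, ← hxv]
    · simp [subsetPaths, extendZero, extendZeroOn, hi, linePath, ← hxw]
  rw [pathIntegrand, hpt, numer_extendZero_add v hA, thetaTerm_eq_numer, subsetFactor,
    ← Fintype.prod_subtype_mul_prod_subtype (fun i => i ∈ v), div_eq_mul_inv,
    ← Finset.prod_inv_distrib]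
  have hv : ∀ i : {i // i ∈ v}, (subsetPaths v hε i).wt (x i) = (-1 : ℂ) ^ ⌊y i⌋ := fun i => by
    simp [subsetPaths, residuePath, hxv]
  have hw : ∀ i : {i // i ∉ v}, (subsetPaths v hε i).wt (x i) =
      (Complex.sin (Real.pi * (I * ε i - w i)))⁻¹ := fun i => by
    simp [subsetPaths, linePath, hxw, i.2]
  simp_rw [hv, hw]
  convert mul_mul_mul_comm _ _ _ _

theorem summable_thetaTerm_subInverse (hA : (A.map (fun a => (a : ℝ))).PosDef)
    (ε' : {i // i ∈ v} → ℂ)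
    (x : {i // i ∈ v} → ℂ) {τ : ℂ} (hτ : 0 < τ.im) :
    Summable (thetaTerm (subInverse A v) ε' x τ) := by
  rw [subInverse, toC_inv_eq_map hA]
  exact summable_thetaTerm (hA.inv.submatrix Subtype.val_injective) ε' x hτ

theorem integral_pathIntegrand_subsetPaths (hA : (A.map (fun a => (a : ℝ))).PosDef)
    (u : Fin n → ℂ) {τ : ℂ} (hτ : 0 < τ.im) (w : {i // i ∉ v} → ℝ) :
    ∫ y : {i // i ∈ v} → ℝ, pathIntegrand (toC A)⁻¹ u τ (subsetPaths v hε)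
        ((MeasurableEquiv.piEquivPiSubtypeProd (fun _ : Fin n => ℝ) (· ∈ v)).symm (y, w)) =
      subsetIntegrand A v ε u τ w := by
  simp_rw [pathIntegrand_subsetPaths v hε hA, integral_mul_const]
  rw [integral_comp_floor_eq_tsum (summable_thetaTerm_subInverse v hA _ _ hτ)]
  rfl

include hε in
theorem integrable_subsetIntegrand (hA : (A.map (fun a => (a : ℝ))).PosDef)
    (u : Fin n → ℂ) {τ : ℂ} (hτ : 0 < τ.im) : Integrable (subsetIntegrand A v ε u τ) ∧
      pathIntegral (toC A)⁻¹ u τ (subsetPaths v hε) = subsetIntegral A v ε u τ := by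
  have hmp := (volume_preserving_splitCoordinates fun i => i ∈ v).symm
  have hint := (hmp.integrable_comp_emb (MeasurableEquiv.measurableEmbedding _)).2
    (toC_inv_eq_map hA ▸ integrable_pathIntegrand hA.inv u hτ (subsetPaths v hε))
  constructor
  · have := hint.integral_prod_right
    simpa only [Function.comp_def, integral_pathIntegrand_subsetPaths v hε hA u hτ] using this
  · rw [pathIntegral, ← hmp.integral_comp', subsetIntegral]
    have := integral_prod_symm _ hint
    simpa only [Function.comp_def, integral_pathIntegrand_subsetPaths v hε hA u hτ] using this

/-- The evaluation of the contour integral. -/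
theorem contourIntegral_eq_sum (hA : (A.map (fun a => (a : ℝ))).PosDef)
    (hε : ∀ j, (ε j).re ≠ 0) (u : Fin n → ℂ) {τ : ℂ} (hτ : 0 < τ.im) :
    contourIntegral A ε u τ = ∑ v : Finset (Fin n) with v.Nonempty,
      I ^ v.card * (∏ j ∈ v, (1 + (Real.sign (ε j).re : ℂ))) * subsetIntegral A v ε u τ := by
  have h0 : planeIntegral 0 (integrand A ε u τ) =
      pathIntegral (toC A)⁻¹ u τ (fun j => linePath (ε j) 0 (hε j)) :=
    planeIntegral_eq_pathIntegral (α := 0) hε u τ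
  rw [contourIntegral, planeIntegral_eq_pathIntegral (shiftVector_ne hε), h0]
  have hexp := pathIntegral_piecewise hA.inv u hτ
    (S := fun j => linePath (ε j) (shiftVector ε j) (shiftVector_ne hε j))
    (T := fun j => linePath (ε j) 0 (hε j)) (R := fun j => residuePath (ε j))
    (fun j => gaussRelation_line (hε j) rfl (shiftVector_ne hε j)) Finset.univ
    (fun j => linePath (ε j) 0 (hε j))
  simp only [Finset.piecewise_univ, Finset.powerset_univ] at hexp
  rw [← toC_inv_eq_map hA] at hexp
  rw [hexp, ← Finset.sum_filter_add_sum_filter_not _ (fun v : Finset (Fin n) => v.Nonempty)]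
  -- The empty subset contributes the integral over `ℝⁿ`, which the definition of `I` subtracts.
  have hempty : (Finset.univ.filter fun v : Finset (Fin n) => ¬v.Nonempty) = {∅} := by
    ext v; simp [Finset.not_nonempty_iff_eq_empty]
  rw [hempty, Finset.sum_singleton]
  simp only [Finset.prod_empty, one_mul, Finset.piecewise_empty, add_sub_cancel_right]
  refine Finset.sum_congr rfl fun v _ => ?_
  rw [Finset.prod_mul_distrib, Finset.prod_const, ← (integrable_subsetIntegrand v hε hA u hτ).2]
  rfl

end Subsets

/-! ### Gaussian integrals in several variables -/

section GaussianIntegral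

theorem integral_comp_mulVec {ι : Type*} [Fintype ι] [DecidableEq ι] {M : Matrix ι ι ℝ}
    (hM : M.det ≠ 0) (f : (ι → ℝ) → ℂ) :
    ∫ x, f x = ((|M.det| : ℝ) : ℂ) * ∫ y, f (M *ᵥ y) := by
  have hmap := Real.map_matrix_volume_pi_eq_smul_volume_pi hM
  have he : MeasurableEmbedding (Matrix.toLin' M) :=
    ((Matrix.toLin' M).toContinuousLinearMap.continuous).measurableEmbedding
      (Matrix.mulVec_injective_iff_isUnit.2 ((Matrix.isUnit_iff_isUnit_det M).2 hM.isUnit))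
  have h := he.integral_map (μ := volume) f
  rw [hmap, integral_smul_measure, ENNReal.toReal_ofReal (abs_nonneg _)] at h
  have h' : ∫ y, f (M *ᵥ y) = |M.det⁻¹| • ∫ x, f x := by rw [h]; rfl
  rw [h', abs_inv, Complex.real_smul, ofReal_inv,
    mul_inv_cancel_left₀ (ofReal_ne_zero.2 (abs_ne_zero.2 hM))]

variable {n : ℕ} {A : Matrix (Fin n) (Fin n) ℤ}

/-- The Gaussian integral with a linear term. -/
theorem integral_exp_quadratic_add_linear (hA : (A.map (fun a => (a : ℝ))).PosDef) {τ : ℂ}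
    (hτ : 0 < τ.im) (c : Fin n → ℂ) :
    ∫ x : Fin n → ℝ, cexp (Real.pi * I * τ * ((fun i => (x i : ℂ)) ⬝ᵥ (toC A)⁻¹ *ᵥ
        (fun i => (x i : ℂ))) + c ⬝ᵥ (fun i => (x i : ℂ))) =
      (Real.sqrt (A.det : ℝ) : ℂ) / (-I * τ) ^ ((n : ℂ) / 2) *
        cexp (-(c ⬝ᵥ toC A *ᵥ c) / (4 * Real.pi * I * τ)) := by
  -- Substituting `x = Nᵀ y` turns the form of `A⁻¹` into a sum of squares, with Jacobian `√(det
  -- A)`.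
  obtain ⟨N, hN, hdet⟩ := exists_transpose_mul_self hA
  set N' : Matrix (Fin n) (Fin n) ℂ := N.map ofReal with hN'
  have hτ0 : τ ≠ 0 := by rintro rfl; simp at hτ
  have hNT : Nᵀ.det ≠ 0 := by rw [Matrix.det_transpose]; exact hdet.ne_zero
  have hdetA : |Nᵀ.det| = Real.sqrt (A.det : ℝ) := by
    have h : ((A.det : ℤ) : ℝ) = N.det * N.det := by
      have h1 : ((A.det : ℤ) : ℝ) = (A.map (fun a => (a : ℝ))).det :=
        RingHom.map_det (Int.castRingHom ℝ) A
      rw [h1, hN, Matrix.det_mul, Matrix.det_transpose]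
    rw [h, Real.sqrt_mul_self_eq_abs, Matrix.det_transpose]
  have hAN : toC A = N'ᵀ * N' := by
    rw [toC_eq_map, hN]
    exact Matrix.map_mul (f := ofRealHom)
  have hq : ∀ y : Fin n → ℝ, (fun i => ((Nᵀ *ᵥ y) i : ℂ)) ⬝ᵥ (toC A)⁻¹ *ᵥ
      (fun i => ((Nᵀ *ᵥ y) i : ℂ)) = ∑ i, (y i : ℂ) ^ 2 := by
    intro y
    rw [toC_inv_eq_map hA, ofReal_dotProduct_mulVec, hN, Matrix.mul_inv_rev,
      Matrix.mulVec_mulVec, Matrix.mul_assoc, Matrix.nonsing_inv_mul _ hNT.isUnit, Matrix.mul_one,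
      Matrix.mulVec_transpose, ← Matrix.dotProduct_mulVec, Matrix.mulVec_mulVec,
      Matrix.mul_nonsing_inv _ hdet, Matrix.one_mulVec]
    simp [dotProduct, sq]
  have hl : ∀ y : Fin n → ℝ, c ⬝ᵥ (fun i => ((Nᵀ *ᵥ y) i : ℂ)) =
      ∑ i, (N' *ᵥ c) i * (y i : ℂ) := by
    intro y
    have e : (fun i => ((Nᵀ *ᵥ y) i : ℂ)) = N'ᵀ *ᵥ (fun i => (y i : ℂ)) := by
      ext i
      simp [Matrix.mulVec, dotProduct, hN']
    rw [e, Matrix.dotProduct_mulVec, Matrix.vecMul_transpose]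
    rfl
  have hc : ∑ i, (N' *ᵥ c) i ^ 2 = c ⬝ᵥ toC A *ᵥ c := by
    rw [hAN, ← Matrix.mulVec_mulVec, Matrix.dotProduct_mulVec, Matrix.vecMul_transpose]
    simp [dotProduct, sq]
  rw [integral_comp_mulVec hNT, hdetA]
  simp_rw [hq, hl]
  have hb : 0 < (-(Real.pi * I * τ)).re := by
    simp
    have := Real.pi_pos
    positivity
  have h := GaussianFourier.integral_cexp_neg_mul_sum_add hb (N' *ᵥ c)
  rw [neg_neg, hc, Fintype.card_fin] at h
  rw [h]
  have hpi : (Real.pi : ℂ) ≠ 0 := ofReal_ne_zero.2 Real.pi_ne_zero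
  have e1 : (Real.pi : ℂ) / -(Real.pi * I * τ) = (-I * τ)⁻¹ := by
    field_simp
  -- The real part of `-i τ` is `Im τ > 0`, so the principal power commutes with inversion.
  have e2 : (-I * τ).arg ≠ Real.pi := by
    intro h
    have := (Complex.arg_eq_pi_iff.1 h).1
    simp at this
    linarith
  have e3 : c ⬝ᵥ toC A *ᵥ c / (4 * -(Real.pi * I * τ)) =
      -(c ⬝ᵥ toC A *ᵥ c) / (4 * Real.pi * I * τ) := by
    rw [neg_div, mul_neg, div_neg, mul_assoc 4, mul_assoc 4]
  rw [e1, e3, Complex.inv_cpow _ _ e2]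
  ring

/-- The Gaussian integral over a translate of the real subspace. -/
theorem integral_exp_quadratic_add_linear_shift (hA : (A.map (fun a => (a : ℝ))).PosDef) {τ : ℂ}
    (hτ : 0 < τ.im) (c ζ : Fin n → ℂ) :
    ∫ x : Fin n → ℝ, cexp (Real.pi * I * τ * (((fun i => (x i : ℂ)) + ζ) ⬝ᵥ (toC A)⁻¹ *ᵥ
        ((fun i => (x i : ℂ)) + ζ)) + c ⬝ᵥ ((fun i => (x i : ℂ)) + ζ)) =
      (Real.sqrt (A.det : ℝ) : ℂ) / (-I * τ) ^ ((n : ℂ) / 2) *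
        cexp (-(c ⬝ᵥ toC A *ᵥ c) / (4 * Real.pi * I * τ)) := by
  set B := (toC A)⁻¹ with hB
  have hτ0 : τ ≠ 0 := by rintro rfl; simp at hτ
  have hpi : (Real.pi : ℂ) ≠ 0 := ofReal_ne_zero.2 Real.pi_ne_zero
  have hBs := dotProduct_mulVec_comm_of_transpose_eq (toC_inv_transpose hA)
  have hAs := dotProduct_mulVec_comm_of_transpose_eq (toC_transpose hA)
  set c' : Fin n → ℂ := c + (2 * Real.pi * I * τ) • (B *ᵥ ζ) with hc'
  have hexp : ∀ x : Fin n → ℝ, cexp (Real.pi * I * τ * (((fun i => (x i : ℂ)) + ζ) ⬝ᵥ B *ᵥ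
        ((fun i => (x i : ℂ)) + ζ)) + c ⬝ᵥ ((fun i => (x i : ℂ)) + ζ)) =
      cexp (Real.pi * I * τ * ((fun i => (x i : ℂ)) ⬝ᵥ B *ᵥ (fun i => (x i : ℂ))) +
        c' ⬝ᵥ (fun i => (x i : ℂ))) * cexp (Real.pi * I * τ * (ζ ⬝ᵥ B *ᵥ ζ) + c ⬝ᵥ ζ) := by
    intro x
    rw [← Complex.exp_add]
    congr 1
    simp only [hc', Matrix.mulVec_add, dotProduct_add, add_dotProduct, smul_dotProduct, smul_eq_mul]
    rw [dotProduct_comm (B *ᵥ ζ), hBs ζ]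
    ring
  simp_rw [hexp, integral_mul_const]
  rw [integral_exp_quadratic_add_linear hA hτ, mul_assoc, ← Complex.exp_add]
  congr 2
  have hAB : toC A *ᵥ (B *ᵥ ζ) = ζ := by
    rw [Matrix.mulVec_mulVec, Matrix.mul_nonsing_inv _ (isUnit_det_toC hA), Matrix.one_mulVec]
  have hcc : c' ⬝ᵥ toC A *ᵥ c' = c ⬝ᵥ toC A *ᵥ c + 2 * (2 * Real.pi * I * τ) * (c ⬝ᵥ ζ) +
      (2 * Real.pi * I * τ) ^ 2 * (ζ ⬝ᵥ B *ᵥ ζ) := by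
    simp only [hc', Matrix.mulVec_add, Matrix.mulVec_smul, dotProduct_add, add_dotProduct,
      smul_dotProduct, dotProduct_smul, smul_eq_mul]
    rw [hAs (B *ᵥ ζ) c, hAB, dotProduct_comm (B *ᵥ ζ) ζ]
    ring
  rw [hcc]
  field_simp
  ring

end GaussianIntegral

/-! ### The partial theta function as an integral -/

section PartialThetaExpansion

variable {n : ℕ} {A : Matrix (Fin n) (Fin n) ℤ}

/-- The integrand is a Gaussian with linear coefficient `2 π i (κ - u)`. Its integral does not
depend on `α`; the prefactor cancels the normalization and the `(u, A u)` part of the exponent. -/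
theorem integral_numer_mul_prod_cscTerm (hA : (A.map (fun a => (a : ℝ))).PosDef) {τ : ℂ}
    (hτ : 0 < τ.im) (ε u : Fin n → ℂ) (α : Fin n → ℝ) (k : Fin n → ℕ) :
    prefactor A u τ * ∫ w : Fin n → ℝ, numer (toC A)⁻¹ u τ (shiftedPoint α w) *
        ∏ j, cscTerm (I * ε j - shiftedPoint α w j) (k j) =
      partialThetaTerm A ε (fun j => u j / τ) (-1 / τ) k := by
  have hτ0 : τ ≠ 0 := by rintro rfl; simp at hτ
  have hpi : (Real.pi : ℂ) ≠ 0 := ofReal_ne_zero.2 Real.pi_ne_zero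
  have hAs := dotProduct_mulVec_comm_of_transpose_eq (toC_transpose hA)
  set κ := halfShift k with hκ
  set c : Fin n → ℂ := (2 * Real.pi * I) • (κ - u) with hc
  have hterm : ∀ w : Fin n → ℝ, numer (toC A)⁻¹ u τ (shiftedPoint α w) *
        ∏ j, cscTerm (I * ε j - shiftedPoint α w j) (k j) =
      (2 * I) ^ n * cexp (2 * Real.pi * (κ ⬝ᵥ ε)) *
        cexp (Real.pi * I * τ * (((fun i => (w i : ℂ)) + fun i => I * (α i : ℂ)) ⬝ᵥ (toC A)⁻¹ *ᵥ
        ((fun i => (w i : ℂ)) + fun i => I * (α i : ℂ))) +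
        c ⬝ᵥ ((fun i => (w i : ℂ)) + fun i => I * (α i : ℂ))) := by
    intro w
    have hz : ((fun i => (w i : ℂ)) + fun i => I * (α i : ℂ)) = shiftedPoint α w := rfl
    rw [hz]
    set z := shiftedPoint α w
    simp only [cscTerm, Finset.prod_mul_distrib, Finset.prod_const, Finset.card_univ,
      Fintype.card_fin]
    rw [numer_eq_exp, ← Complex.exp_sum, mul_left_comm, ← mul_pow, ← Complex.exp_add,
      mul_assoc _ (cexp _), ← Complex.exp_add]
    congr 2
    have hs : ∑ j, -(2 * Real.pi * I * (I * ε j - z j) * ((k j : ℂ) + 1 / 2)) =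
        2 * Real.pi * (κ ⬝ᵥ ε) + 2 * Real.pi * I * (κ ⬝ᵥ z) := by
      simp only [dotProduct, Finset.mul_sum]
      rw [← Finset.sum_add_distrib]
      refine Finset.sum_congr rfl fun j _ => ?_
      simp only [hκ, halfShift]
      linear_combination (-2 * Real.pi * ε j * (k j + 1 / 2)) * I_sq
    rw [hs, hc, smul_dotProduct, sub_dotProduct, smul_eq_mul]
    ring
  simp_rw [hterm, integral_const_mul]
  rw [integral_exp_quadratic_add_linear_shift hA hτ, prefactor, partialThetaTerm, ← hκ, qPow]
  have hsq : (Real.sqrt (A.det : ℝ) : ℂ) ≠ 0 := by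
    have h1 : ((A.det : ℤ) : ℝ) = (A.map (fun a => (a : ℝ))).det :=
      RingHom.map_det (Int.castRingHom ℝ) A
    rw [h1]
    exact ofReal_ne_zero.2 (Real.sqrt_pos.2 hA.det_pos).ne'
  have hpow : (-I * τ) ^ ((n : ℂ) / 2) ≠ 0 := by
    rw [Ne, Complex.cpow_eq_zero_iff]
    simp [hτ0]
  have h2I : ((2 * I : ℂ) ^ n) ≠ 0 := pow_ne_zero _ (by simp)
  have hu : (fun j => u j / τ) = τ⁻¹ • u := by ext j; simp [div_eq_inv_mul]
  have hfin : Real.pi * I / τ * (u ⬝ᵥ toC A *ᵥ u) + -(c ⬝ᵥ toC A *ᵥ c) / (4 * Real.pi * I * τ) =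
      2 * Real.pi * I * (-1 / τ) * (1 / 2 * (κ ⬝ᵥ toC A *ᵥ κ)) +
        2 * Real.pi * I * (κ ⬝ᵥ toC A *ᵥ fun j => u j / τ) := by
    rw [hu]
    simp only [hc, Matrix.mulVec_smul, Matrix.mulVec_sub, smul_dotProduct, dotProduct_smul,
      sub_dotProduct, dotProduct_sub, smul_eq_mul]
    rw [hAs u κ]
    field_simp
    ring
  calc _ = cexp (Real.pi * I / τ * (u ⬝ᵥ toC A *ᵥ u)) *
        cexp (-(c ⬝ᵥ toC A *ᵥ c) / (4 * Real.pi * I * τ)) * cexp (2 * Real.pi * (κ ⬝ᵥ ε)) := by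
        field_simp
    _ = _ := by rw [← Complex.exp_add, hfin, Complex.exp_add]

/-- The partial theta function as an integral over a translate of the real subspace. -/
theorem hasSum_partialThetaTerm (hA : (A.map (fun a => (a : ℝ))).PosDef) {τ : ℂ}
    (hτ : 0 < τ.im) (ε u : Fin n → ℂ) {α : Fin n → ℝ} (hα : ∀ j, (ε j).re < α j) :
    HasSum (partialThetaTerm A ε (fun j => u j / τ) (-1 / τ))
      (prefactor A u τ * planeIntegral α (integrand A ε u τ)) := by
  have hψ : Integrable fun w : Fin n → ℝ => numer (toC A)⁻¹ u τ (shiftedPoint α w) := by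
    rw [toC_inv_eq_map hA]
    -- Lines of weight `1`, so that the general integrability result covers the numerator without
    -- cosecants.
    let P : ∀ j : Fin n, WeightedPath := fun j =>
      { pt := fun x => x + I * α j
        wt := fun _ => 1
        measurable_pt := by fun_prop
        measurable_wt := measurable_const
        bound := 1 + |α j|
        abs_im_pt_le := fun x => by simp
        abs_re_pt_sub_le := fun x => by simp; positivity
        norm_wt_le := fun x => by simp }
    have h := integrable_pathIntegrand hA.inv u hτ P
    refine h.congr (Filter.Eventually.of_forall fun w => ?_)
    simp [pathIntegrand, P]
    rfl
  have h := hasSum_integral_mul_cscTerm hψ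
    (z := fun j (w : Fin n → ℝ) => I * ε j - shiftedPoint α w j)
    (fun j => by unfold shiftedPoint; fun_prop) (s := fun j => (ε j).re - α j)
    (fun j => sub_neg.2 (hα j)) (fun j w => by simp [shiftedPoint])
  have h' := h.mul_left (prefactor A u τ)
  simp_rw [integral_numer_mul_prod_cscTerm hA hτ ε u α] at h'
  exact h'

end PartialThetaExpansion

end PartialTheta

theorem mainTheorem1 (n : ℕ) (A : Matrix (Fin n) (Fin n) ℤ)
    (hA : (A.map (fun a => (a : ℝ))).PosDef) (ε u : Fin n → ℂ) (hε : ∀ j, (ε j).re ≠ 0)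
    (τ : ℂ) (hτ : 0 < τ.im) :
    -- all the series and integrals involved converge absolutely
    Summable (PartialTheta.partialThetaTerm A ε (fun j => u j / τ) (-1 / τ)) ∧
    Integrable (fun w : Fin n → ℝ =>
      PartialTheta.integrand A ε u τ (PartialTheta.shiftedPoint 0 w)) ∧
    Integrable (fun w : Fin n → ℝ =>
      PartialTheta.integrand A ε u τ
        (PartialTheta.shiftedPoint (PartialTheta.shiftVector ε) w)) ∧
    (∀ v : Finset (Fin n), v.Nonempty →
      (∀ w : {i // i ∉ v} → ℝ,
        Summable (PartialTheta.thetaTerm (PartialTheta.subInverse A v)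
          (PartialTheta.restrict v ε) (PartialTheta.thetaArgument A v u τ w) τ)) ∧
      Integrable (PartialTheta.subsetIntegrand A v ε u τ)) ∧
    -- the evaluation of the contour integral
    PartialTheta.contourIntegral A ε u τ =
      ∑ v : Finset (Fin n) with v.Nonempty,
        I ^ v.card * (∏ j ∈ v, (1 + (Real.sign (ε j).re : ℂ))) *
          PartialTheta.subsetIntegral A v ε u τ ∧
    -- the transformation formula
    PartialTheta.partialTheta A ε (fun j => u j / τ) (-1 / τ) =
      PartialTheta.continuousPart A ε u τ +
        PartialTheta.prefactor A u τ * PartialTheta.contourIntegral A ε u τ := by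
  have hP := PartialTheta.hasSum_partialThetaTerm hA hτ ε u
    (PartialTheta.lt_shiftVector hε)
  refine ⟨hP.summable, PartialTheta.integrable_integrand_shiftedPoint hε u hA hτ,
    PartialTheta.integrable_integrand_shiftedPoint (PartialTheta.shiftVector_ne hε) u hA hτ,
    fun v _ => ⟨fun w => PartialTheta.summable_thetaTerm_subInverse v hA _ _ hτ,
      (PartialTheta.integrable_subsetIntegrand v hε hA u hτ).1⟩,
    PartialTheta.contourIntegral_eq_sum hA hε u hτ, ?_⟩
  rw [PartialTheta.partialTheta, hP.tsum_eq, PartialTheta.continuousPart,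
    PartialTheta.contourIntegral]
  ring
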